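/- Let $\tau=u+iv$ denote a point of the upper half-plane $\mathbb{H}$, let $q=e^{2\pi i\tau}$ and $q^{m/h}=e^{2\pi i m\tau/h}$. Let $E_2(\tau)=1-24\sum_{n\ge1}\sigma_1(n)q^n$, let $\eta(\tau)=q^{1/24}\prod_{\ell\ge1}(1-q^\ell)$, and let $$F(\tau)=\frac{E_2(\tau)-2E_2(2\tau)-3E_2(3\tau)+6E_2(6\tau)}{2\,\eta(\tau)^2\eta(2\tau)^2\eta(3\tau)^2\eta(6\tau)^2},\qquad P=-R_{-2}(F),\qquad R_k=\frac1{2\pi i}\frac{\partial}{\partial\tau}-\frac{k}{4\pi v},$$ where $\frac{\partial}{\partial\tau}=\frac12\left(\frac{\partial}{\partial u}-i\frac{\partial}{\partial v}\right)$. For $\gamma=\begin{pmatrix}a&b\\c&d\end{pmatrix}\in\mathrm{SL}_2(\mathbb{Z})$ put $f|_k\gamma(\tau)=(c\tau+d)^{-k}f\left(\frac{a\tau+b}{c\tau+d}\right)$. Put $T=\begin{pmatrix}1&1\\0&1\end{pmatrix}$ and let $\gamma$ be one of the following $12$ representatives of the cosets $\Gamma_0(6)\gamma$ in $\mathrm{SL}_2(\mathbb{Z})$: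 $$\begin{pmatrix}1&0\\0&1\end{pmatrix};\quad \begin{pmatrix}1&0\\3&1\end{pmatrix}T^r\ (0\le r\le1);\quad \begin{pmatrix}1&1\\2&3\end{pmatrix}T^s\ (0\le s\le2);\quad \begin{pmatrix}0&-1\\1&0\end{pmatrix}T^t\ (0\le t\le5).$$ Let $h$ be the width of the cusp $\gamma\infty$ of $\Gamma_0(6)$, that is, the least integer $h\ge1$ with $\pm\gamma T^h\gamma^{-1}\in\Gamma_0(6)$. Then there is a $6$th root of unity $\zeta$ (that is, $\zeta^6=1$), depending only on $\gamma$, such that $F|_{-2}\gamma$ has on $\mathbb{H}$ a convergent expansion $$F|_{-2}\gamma(\tau)=h\zeta q^{-1/h}+a_0+a_1q^{1/h}+a_2q^{2/h}+\cdots$$ with complex coefficients $a_m$, and such that for every $\tau$ in the fundamental domain $$\mathcal F=\left\{\tau\in\mathbb{H}:-\tfrac12<\mathrm{Re}\,\tau\le\tfrac12,\ |\tau|>1\right\}\cup\left\{\tau\in\mathbb{H}:|\tau|=1,\ 0\le\mathrm{Re}\,\tau\le\tfrac12\right\}$$ one has $$P|_0\gamma(\tau)=\zeta\left(1-\frac{h}{2\pi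 v}\right)e^{-2\pi i\tau/h}+E_\gamma(\tau),\qquad |E_\gamma(\tau)|\le 1334.42 .$$ -/

import Mathlib

open UpperHalfPlane hiding I
open scoped MatrixGroups ModularForm

noncomputable section

namespace PartitionMaass

/-- The point `n τ` of the upper half-plane, for a positive integer `n`. -/
def dilate (n : ℕ) (hn : 0 < n) (τ : ℍ) : ℍ :=
  ⟨(n : ℂ) * (τ : ℂ), by
    have h : 0 < (n : ℝ) * τ.im := mul_pos (Nat.cast_pos.mpr hn) τ.im_pos
    simpa using h⟩

/-- The function
`F(τ) = (E₂(τ) - 2 E₂(2τ) - 3 E₂(3τ) + 6 E₂(6τ)) / (2 η(τ)² η(2τ)² η(3τ)² η(6τ)²)`. -/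
def F (τ : ℍ) : ℂ :=
  (EisensteinSeries.E2 τ
      - 2 * EisensteinSeries.E2 (dilate 2 (by norm_num) τ)
      - 3 * EisensteinSeries.E2 (dilate 3 (by norm_num) τ)
      + 6 * EisensteinSeries.E2 (dilate 6 (by norm_num) τ)) /
    (2 * ModularForm.eta (τ : ℂ) ^ 2 * ModularForm.eta (2 * (τ : ℂ)) ^ 2 *
      ModularForm.eta (3 * (τ : ℂ)) ^ 2 * ModularForm.eta (6 * (τ : ℂ)) ^ 2)

/-- The Wirtinger derivative `∂f/∂τ = (∂f/∂u - i ∂f/∂v) / 2`, where `τ = u + i v`. -/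
def wirtinger (f : ℍ → ℂ) (τ : ℍ) : ℂ :=
  (fderiv ℝ (f ∘ ofComplex) (τ : ℂ) 1 -
    Complex.I * fderiv ℝ (f ∘ ofComplex) (τ : ℂ) Complex.I) / 2

/-- The Maass raising operator `R_k = (1 / (2πi)) ∂/∂τ - k / (4πv)`. -/
def raising (k : ℤ) (f : ℍ → ℂ) (τ : ℍ) : ℂ :=
  1 / (2 * (Real.pi : ℂ) * Complex.I) * wirtinger f τ
    - (k : ℂ) / (4 * (Real.pi : ℂ) * (τ.im : ℂ)) * f τ

/-- The weight `0` function `P = -R₋₂(F)`. -/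
def P (τ : ℍ) : ℂ := -raising (-2) F τ

/-- The matrix with rows `(1, 0)` and `(3, 1)`, which maps `∞` to `1/3`. -/
def gammaThird : SL(2, ℤ) := ⟨!![1, 0; 3, 1], by simp [Matrix.det_fin_two]⟩

/-- The matrix with rows `(1, 1)` and `(2, 3)`, which maps `∞` to `1/2`. -/
def gammaHalf : SL(2, ℤ) := ⟨!![1, 1; 2, 3], by simp [Matrix.det_fin_two]⟩

/-- The matrix with rows `(0, -1)` and `(1, 0)`, which maps `∞` to `0`. -/
def gammaZero : SL(2, ℤ) := ⟨!![0, -1; 1, 0], by simp [Matrix.det_fin_two]⟩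

/-- The twelve chosen representatives of the cosets `Γ₀(6) γ` in `SL₂(ℤ)`;
`ModularGroup.T` is the matrix with rows `(1, 1)` and `(0, 1)`. -/
def cosetReps : Set SL(2, ℤ) :=
  {γ | γ = 1 ∨
    (∃ r : ℕ, r < 2 ∧ γ = gammaThird * ModularGroup.T ^ r) ∨
    (∃ s : ℕ, s < 3 ∧ γ = gammaHalf * ModularGroup.T ^ s) ∨
    (∃ t : ℕ, t < 6 ∧ γ = gammaZero * ModularGroup.T ^ t)}

/-- The width of the cusp `γ ∞` for a subgroup `Γ` of `SL₂(ℤ)`: the least integer `m ≥ 1` with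
`± γ T ^ m γ⁻¹ ∈ Γ` (and `0` if there is none, which does not happen for finite index). -/
def cuspWidth (Γ : Subgroup SL(2, ℤ)) (γ : SL(2, ℤ)) : ℕ :=
  sInf {m : ℕ | 0 < m ∧ (γ * ModularGroup.T ^ m * γ⁻¹ ∈ Γ ∨ -(γ * ModularGroup.T ^ m * γ⁻¹) ∈ Γ)}

/-- The function `f` has an expansion `h ζ q^(-1/h) + a₀ + a₁ q^(1/h) + a₂ q^(2/h) + ⋯`
on the whole upper half-plane, where `q^(m/h) = exp(2πi m τ / h)`. -/
def HasPolarExpansion (f : ℍ → ℂ) (h : ℕ) (ζ : ℂ) : Prop :=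
  ∃ a : ℕ → ℂ, ∀ τ : ℍ,
    HasSum (fun m : ℕ => a m * Complex.exp (2 * Real.pi * Complex.I * m * τ / h))
      (f τ - h * ζ * Complex.exp (-(2 * Real.pi * Complex.I * τ / h)))

/-- The usual fundamental domain for `SL₂(ℤ)`, with half of its boundary. -/
def fundDomain : Set ℍ :=
  {τ | (-(1 / 2 : ℝ) < τ.re ∧ τ.re ≤ 1 / 2 ∧ 1 < ‖(τ : ℂ)‖) ∨
    (‖(τ : ℂ)‖ = 1 ∧ 0 ≤ τ.re ∧ τ.re ≤ 1 / 2)}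

end PartitionMaass

end

noncomputable section

namespace PartitionMaass

section Transformation

open EisensteinSeries

/-! ### Transformation laws of `η ^ 2` and `E₂` -/

/-! The numerator of F is a combination of E₂(dτ), d ∣ 6, with coefficients c_d satisfying ∑ c_d / d
= 0, so the non-modular terms of E₂ cancel. The Atkin–Lehner involutions of level 6 permute the four
divisors d, hence fix F up to sign, and they act transitively on the cusps. This gives F|γ(z) = κ h
F((z + r)/h) with κ = ±1 (`FC_cosetReps`). Since the raising operator commutes with the slash
action, also P|γ(z) = κ P((z + r)/h) (`PC_of_FC`). Everything reduces to the cusp ∞, with ζ = κ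
exp(-2πir/h).

At ∞ write F = q⁻¹ - ∑ c_n qⁿ. The decisive fact is c_n ≥ 0 (`FCoeff_nonneg`). The remainder of P is
∑ c_n (n + 1/(2πy)) qⁿ with y the height; by positivity its modulus is at most its value `rem y` at
the point iy, and `rem` decreases in y. On the fundamental domain v/h ≥ √3/12, so a single number,
`rem (√3 / 12)`, has to be bounded.

No coefficient beyond c_0 enters that bound. The Fricke involution gives P(iy₀) = P(iy₁) for y₀ =
√3/12 and y₁ = 1/(6y₀) = 2√3/3. Both sides are an explicit main term plus `rem`. At the larger
height `rem y₁` is at most 12/(2πy₁) plus a hundredth of `rem y₀` (`rem_le_add`), so the equality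
can be solved for `rem y₀`. -/

/-- The square of the Dedekind eta function. -/
def etaSq (z : ℂ) : ℂ := ModularForm.eta z ^ 2

/-- The Eisenstein series `E₂` as a function on `ℂ`. -/
def eisTwo (z : ℂ) : ℂ := E2 (ofComplex z)

/-- The multiplier of `η ^ 2` under translation by `1`. -/
def etaMult : ℂ := Complex.exp (Real.pi * Complex.I / 6)

lemma etaMult_ne_zero : etaMult ≠ 0 := Complex.exp_ne_zero _

lemma etaMult_pow_three : etaMult ^ 3 = Complex.I := by
  rw [etaMult, ← Complex.exp_nat_mul]
  refine Eq.trans ?_ Complex.exp_pi_div_two_mul_I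
  congr 1
  push_cast
  ring

lemma im_neg_inv_pos {z : ℂ} (hz : 0 < z.im) : 0 < (-1 / z).im := by
  have h : z ≠ 0 := by rintro rfl; simp at hz
  rw [neg_div, one_div, Complex.neg_im, Complex.inv_im, neg_div, neg_neg]
  exact div_pos hz (Complex.normSq_pos.mpr h)

lemma ne_zero_of_im_pos {z : ℂ} (hz : 0 < z.im) : z ≠ 0 := by
  rintro rfl; simp at hz

lemma qParam_one_add_one (z : ℂ) :
    Function.Periodic.qParam 1 (z + 1) = Function.Periodic.qParam 1 z := by
  simp only [Function.Periodic.qParam, Complex.ofReal_one, div_one, mul_add, mul_one,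
    Complex.exp_add, Complex.exp_two_pi_mul_I]

lemma etaSq_add_one (z : ℂ) : etaSq (z + 1) = etaMult * etaSq z := by
  simp only [etaSq, ModularForm.eta, ModularForm.eta_q, qParam_one_add_one, mul_pow,
    ← mul_assoc]
  congr 1
  simp only [Function.Periodic.qParam, etaMult, ← Complex.exp_nat_mul, ← Complex.exp_add]
  congr 1
  push_cast
  ring

lemma etaSq_add_int (n : ℤ) (z : ℂ) : etaSq (z + n) = etaMult ^ n * etaSq z := by
  induction n using Int.induction_on with
  | zero => simp
  | succ k ih =>
    have := etaSq_add_one (z + (k : ℤ))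
    rw [ih] at this
    rw [zpow_add_one₀ etaMult_ne_zero]
    push_cast at this ⊢
    rw [← add_assoc, this]
    ring
  | pred k ih =>
    have := etaSq_add_one (z + (-(k : ℤ) - 1 : ℤ))
    rw [zpow_sub_one₀ etaMult_ne_zero]
    push_cast at this ih ⊢
    rw [show z + (-(k : ℂ) - 1) + 1 = z + -k by ring, ih] at this
    field_simp [etaMult_ne_zero]
    rw [this]
    ring

/-- Squaring replaces the square roots in the law of η by their radicands, so no branch has to be
followed; this is the reason for working with η². -/
lemma etaSq_neg_inv {z : ℂ} (hz : 0 < z.im) : etaSq (-1 / z) = -Complex.I * z * etaSq z := by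
  have h := ModularForm.eta_comp_eq_csqrt_I_inv hz
  have hs : ∀ w : ℂ, Complex.sqrt w ^ 2 = w := fun w => by
    rw [Complex.sqrt]; simp
  simp only [Function.comp, Pi.smul_apply, Pi.mul_apply, smul_eq_mul] at h
  rw [etaSq, h, etaSq, mul_pow, mul_pow, inv_pow, hs, hs, Complex.inv_I]
  ring

lemma eisTwo_add_one {z : ℂ} (hz : 0 < z.im) : eisTwo (z + 1) = eisTwo z := by
  have hz' : 0 < (z + 1).im := by simpa using hz
  rw [eisTwo, eisTwo, ofComplex_apply_of_im_pos hz, ofComplex_apply_of_im_pos hz',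
    E2_eq_tsum_cexp, E2_eq_tsum_cexp]
  have := qParam_one_add_one z
  simp only [Function.Periodic.qParam, Complex.ofReal_one, div_one] at this
  simp only [this]

lemma eisTwo_add_int (n : ℤ) {z : ℂ} (hz : 0 < z.im) : eisTwo (z + n) = eisTwo z := by
  induction n using Int.induction_on with
  | zero => simp
  | succ k ih =>
    have := eisTwo_add_one (z := z + (k : ℤ)) (by simpa using hz)
    rw [ih] at this
    push_cast at this ⊢
    rw [← add_assoc, this]
  | pred k ih =>
    have := eisTwo_add_one (z := z + (-(k : ℤ) - 1 : ℤ)) (by simpa using hz)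
    push_cast at this ih ⊢
    rw [show z + (-(k : ℂ) - 1) + 1 = z + -k by ring, ih] at this
    exact this.symm

lemma eisTwo_neg_inv {z : ℂ} (hz : 0 < z.im) :
    eisTwo (-1 / z) = z ^ 2 * eisTwo z + 6 / (Real.pi * Complex.I) * z := by
  have h0 := ne_zero_of_im_pos hz
  have h := congrFun (E2_slash_action ModularGroup.S) ⟨z, hz⟩
  rw [ModularForm.SL_slash_apply, modular_S_smul] at h
  simp only [Pi.sub_apply, Pi.smul_apply, D2_S, riemannZeta_two,
    smul_eq_mul] at h
  rw [eisTwo, eisTwo, ofComplex_apply_of_im_pos hz, ofComplex_apply_of_im_pos (im_neg_inv_pos hz)]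
  have e : (⟨-1 / z, im_neg_inv_pos hz⟩ : ℍ) = ⟨(-z)⁻¹, by
      have := im_neg_inv_pos hz; rwa [neg_div, one_div, ← inv_neg] at this⟩ := by
    ext
    simp [neg_div, inv_neg]
  rw [e]
  have hpi : (Real.pi : ℂ) ≠ 0 := by exact_mod_cast Real.pi_ne_zero
  have hI := Complex.I_ne_zero
  have hz2 : (z : ℂ) ^ (-2 : ℤ) = (z ^ 2)⁻¹ := by rw [zpow_neg]; norm_cast
  have hd : denom (Matrix.SpecialLinearGroup.toGL ((Matrix.SpecialLinearGroup.map
      (Int.castRingHom ℝ)) ModularGroup.S)) z = z := ModularGroup.denom_S ⟨z, hz⟩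
  rw [hd, hz2] at h
  rw [← div_eq_mul_inv, div_eq_iff (pow_ne_zero 2 h0)] at h
  rw [h]
  field_simp
  linear_combination -6 * Complex.I_sq

lemma im_mobius_pos {z : ℂ} (hz : 0 < z.im) (n : ℤ) : 0 < (-1 / z - n).im := by
  simpa using im_neg_inv_pos hz

lemma mobius_ne_zero {z : ℂ} (hz : 0 < z.im) (n : ℤ) : n * z + 1 ≠ 0 := by
  intro h
  have h1 := ne_zero_of_im_pos (im_mobius_pos hz n)
  apply h1
  have h0 := ne_zero_of_im_pos hz
  field_simp
  linear_combination -h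

/-- Factors the lower triangular matrix into inversion, translation by -n and inversion, so that the
laws for the two generators suffice. -/
lemma mobius_eq {z : ℂ} (hz : 0 < z.im) (n : ℤ) : z / (n * z + 1) = -1 / (-1 / z - n) := by
  have h0 := ne_zero_of_im_pos hz
  have h1 := mobius_ne_zero hz n
  have h2 := ne_zero_of_im_pos (im_mobius_pos hz n)
  rw [div_eq_div_iff h1 h2]
  field_simp
  ring

lemma etaSq_mobius {z : ℂ} (hz : 0 < z.im) (n : ℤ) :
    etaSq (z / (n * z + 1)) = etaMult ^ (-n) * (n * z + 1) * etaSq z := by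
  have h0 := ne_zero_of_im_pos hz
  have h := etaSq_add_int (-n) (-1 / z)
  push_cast at h
  rw [mobius_eq hz, etaSq_neg_inv (im_mobius_pos hz n), sub_eq_add_neg, h, etaSq_neg_inv hz]
  field_simp
  linear_combination (-(n * z + 1) * etaMult ^ (-n) * etaSq z) * Complex.I_sq

lemma eisTwo_mobius {z : ℂ} (hz : 0 < z.im) (n : ℤ) :
    eisTwo (z / (n * z + 1)) =
      (n * z + 1) ^ 2 * eisTwo z + 6 / (Real.pi * Complex.I) * n * (n * z + 1) := by
  have h0 := ne_zero_of_im_pos hz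
  have h := eisTwo_add_int (-n) (im_neg_inv_pos hz)
  push_cast at h
  rw [mobius_eq hz, eisTwo_neg_inv (im_mobius_pos hz n), sub_eq_add_neg, h, eisTwo_neg_inv hz]
  have hpi : (Real.pi : ℂ) ≠ 0 := by exact_mod_cast Real.pi_ne_zero
  have hI := Complex.I_ne_zero
  field_simp
  ring

/-! ### Transformation laws of `F` -/

/-- The numerator of `F` as a function on `ℂ`. -/
def numer (z : ℂ) : ℂ :=
  eisTwo z - 2 * eisTwo (2 * z) - 3 * eisTwo (3 * z) + 6 * eisTwo (6 * z)

/-- Half the denominator of `F` as a function on `ℂ`. -/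
def etaProd (z : ℂ) : ℂ := etaSq z * etaSq (2 * z) * etaSq (3 * z) * etaSq (6 * z)

/-- `F` as a function on `ℂ`. -/
def FC (z : ℂ) : ℂ := numer z / (2 * etaProd z)

lemma F_eq_FC (τ : ℍ) : F τ = FC τ := by
  have h : ∀ n (hn : 0 < n), dilate n hn τ = ofComplex ((n : ℂ) * τ) := fun n hn => by
    have h1 : 0 < ((n : ℂ) * τ).im := (dilate n hn τ).im_pos
    rw [ofComplex_apply_of_im_pos h1]; rfl
  simp only [F, FC, numer, etaProd, eisTwo, etaSq, h, ofComplex_apply, Nat.cast_ofNat]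
  ring_nf

lemma FC_of_numer_etaProd {z w u a b : ℂ} (hu : u ≠ 0) (hN : numer z = a * u ^ 2 * numer w)
    (hD : etaProd z = b * u ^ 4 * etaProd w) : FC z * u ^ 2 = a / b * FC w := by
  rw [FC, FC, hN, hD]
  field_simp

/-- The Fricke involution: d · (-1/z) is the inversion of z/d = (6/d) · (z/6), so the levels d and
6/d are exchanged. -/
lemma FC_neg_inv {z : ℂ} (hz : 0 < z.im) : FC (-1 / z) * z ^ 2 = 6 * FC (z / 6) := by
  have h0 := ne_zero_of_im_pos hz
  have hd : ∀ n : ℝ, 0 < n → 0 < (z / n).im := fun n hn => by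
    rw [Complex.div_ofReal_im]; positivity
  have e : ∀ n : ℝ, 0 < n → (n : ℂ) * (-1 / z) = -1 / (z / n) := fun n hn => by
    have : (n : ℂ) ≠ 0 := by exact_mod_cast hn.ne'
    field_simp
  have e2 := e 2 two_pos
  have e3 := e 3 three_pos
  have e6 := e 6 (by norm_num)
  have h2 := hd 2 two_pos
  have h3 := hd 3 three_pos
  have h6 := hd 6 (by norm_num)
  push_cast at e2 e3 e6 h2 h3 h6
  have w2 : 2 * (z / 6) = z / 3 := by ring
  have w3 : 3 * (z / 6) = z / 2 := by ring
  have w6 : 6 * (z / 6) = z := by ring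
  have hN : numer (-1 / z) = 1 / 6 * z ^ 2 * numer (z / 6) := by
    rw [numer, numer, e2, e3, e6, w2, w3, w6, eisTwo_neg_inv hz, eisTwo_neg_inv h2,
      eisTwo_neg_inv h3, eisTwo_neg_inv h6]
    ring
  have hD : etaProd (-1 / z) = 1 / 36 * z ^ 4 * etaProd (z / 6) := by
    rw [etaProd, etaProd, e2, e3, e6, w2, w3, w6, etaSq_neg_inv hz, etaSq_neg_inv h2,
      etaSq_neg_inv h3, etaSq_neg_inv h6]
    linear_combination (1 / 36 * z ^ 4 * etaSq z * etaSq (z / 6) * etaSq (z / 3) * etaSq (z / 2)) *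
      Complex.I_pow_four
  rw [FC_of_numer_etaProd h0 hN hD]
  norm_num

/-- With w = (z + 1)/2, the multiples of z/(3z + 1) by 1, 2, 3, 6 are images of 2w, w, 6w, 3w under
matrices of level one. This is the Atkin–Lehner involution exchanging d and 2d for odd d. -/
lemma FC_mobius_three {z : ℂ} (hz : 0 < z.im) :
    FC (z / (3 * z + 1)) * (3 * z + 1) ^ 2 = -2 * FC ((z + 1) / 2) := by
  have h3 : 0 < (3 * z).im := by simpa using hz
  have hw : 0 < ((z + 1) / 2).im := by simpa using hz
  have hw' : 0 < ((3 * z + 1) / 2).im := by simpa using hz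
  have hu : 3 * z + 1 ≠ 0 := by simpa using mobius_ne_zero hz 3
  have hv : ((-3 : ℤ) : ℂ) * ((z + 1) / 2) + 1 = -((3 * z + 1) / 2) := by push_cast; ring
  have p1 : z / (3 * z + 1) = z / ((3 : ℤ) * z + 1) := by push_cast; ring
  have p3 : 3 * (z / (3 * z + 1)) = 3 * z / ((1 : ℤ) * (3 * z) + 1) := by push_cast; ring
  have p2 : 2 * (z / (3 * z + 1)) =
      (z + 1) / 2 / ((-3 : ℤ) * ((z + 1) / 2) + 1) + (1 : ℤ) := by
    rw [hv, div_neg, div_div_div_cancel_right₀ two_ne_zero]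
    push_cast
    rw [neg_add_eq_sub, one_sub_div hu]
    ring
  have p6 : 6 * (z / (3 * z + 1)) = -1 / ((3 * z + 1) / 2) + (2 : ℤ) := by
    push_cast
    rw [div_div_eq_mul_div, div_add' _ _ _ hu]
    ring
  have w2 : 2 * ((z + 1) / 2) = z + (1 : ℤ) := by push_cast; ring
  have w3 : 3 * ((z + 1) / 2) = (3 * z + 1) / 2 + (1 : ℤ) := by push_cast; ring
  have w6 : 6 * ((z + 1) / 2) = 3 * z + (3 : ℤ) := by push_cast; ring
  have him : ∀ (w : ℂ) (n : ℤ), 0 < w.im → 0 < (w / (n * w + 1)).im := fun w n hw => by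
    rw [mobius_eq hw]; exact im_neg_inv_pos (im_mobius_pos hw n)
  have hN : numer (z / (3 * z + 1)) = -1 / 2 * (3 * z + 1) ^ 2 * numer ((z + 1) / 2) := by
    rw [numer, numer, p2, p3, p6, p1, w2, w3, w6, eisTwo_add_int _ (him _ _ hw),
      eisTwo_add_int _ (im_neg_inv_pos hw'), eisTwo_add_int _ hw', eisTwo_add_int _ hz,
      eisTwo_add_int _ h3, eisTwo_mobius hz, eisTwo_mobius h3, eisTwo_mobius hw,
      eisTwo_neg_inv hw']
    push_cast
    ring
  have hD : etaProd (z / (3 * z + 1)) = 1 / 4 * (3 * z + 1) ^ 4 * etaProd ((z + 1) / 2) := by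
    have hω := etaMult_ne_zero
    rw [etaProd, etaProd, p2, p3, p6, p1, w2, w3, w6, etaSq_add_int, etaSq_add_int, etaSq_add_int,
      etaSq_add_int, etaSq_add_int, etaSq_mobius hz, etaSq_mobius h3, etaSq_mobius hw,
      etaSq_neg_inv hw', hv]
    simp only [zpow_neg, zpow_ofNat, neg_neg, Int.cast_one, Int.cast_ofNat]
    field_simp
    -- Of the translation multipliers only a cube of the twelfth root of unity survives; it equals i
    -- and matches the factor from the inversion.
    rw [etaMult_pow_three]
    ring
  rw [FC_of_numer_etaProd hu hN hD]
  norm_num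

/-- The same with w = (z - 1)/3: the multiples by 1, 2, 3, 6 come from 3w, 6w, w, 2w, exchanging d
and 3d for d prime to 3. -/
lemma FC_mobius_two {z : ℂ} (hz : 0 < z.im) :
    FC (z / (2 * z + 1)) * (2 * z + 1) ^ 2 = -3 * FC ((z - 1) / 3) := by
  have h3 : 0 < (2 * z).im := by simpa using hz
  have hw : 0 < ((z - 1) / 3).im := by simpa using hz
  have hw' : 0 < ((2 * z + 1) / 3).im := by simpa using hz
  have hu : 2 * z + 1 ≠ 0 := by simpa using mobius_ne_zero hz 2
  have hv : ((2 : ℤ) : ℂ) * ((z - 1) / 3) + 1 = (2 * z + 1) / 3 := by push_cast; ring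
  have p1 : z / (2 * z + 1) = z / ((2 : ℤ) * z + 1) := by push_cast; ring
  have p2 : 2 * (z / (2 * z + 1)) = 2 * z / ((1 : ℤ) * (2 * z) + 1) := by push_cast; ring
  have p3 : 3 * (z / (2 * z + 1)) =
      (z - 1) / 3 / ((2 : ℤ) * ((z - 1) / 3) + 1) + (1 : ℤ) := by
    rw [hv, div_div_div_cancel_right₀ three_ne_zero]
    push_cast
    rw [div_add_one hu]
    ring
  have p6 : 6 * (z / (2 * z + 1)) = -1 / ((2 * z + 1) / 3) + (3 : ℤ) := by
    push_cast
    rw [div_div_eq_mul_div, div_add' _ _ _ hu]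
    ring
  have w2 : 2 * ((z - 1) / 3) = (2 * z + 1) / 3 + (-1 : ℤ) := by push_cast; ring
  have w3 : 3 * ((z - 1) / 3) = z + (-1 : ℤ) := by push_cast; ring
  have w6 : 6 * ((z - 1) / 3) = 2 * z + (-2 : ℤ) := by push_cast; ring
  have him : ∀ (w : ℂ) (n : ℤ), 0 < w.im → 0 < (w / (n * w + 1)).im := fun w n hw => by
    rw [mobius_eq hw]; exact im_neg_inv_pos (im_mobius_pos hw n)
  have hN : numer (z / (2 * z + 1)) = -1 / 3 * (2 * z + 1) ^ 2 * numer ((z - 1) / 3) := by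
    rw [numer, numer, p2, p3, p6, p1, w2, w3, w6, eisTwo_add_int _ (him _ _ hw),
      eisTwo_add_int _ (im_neg_inv_pos hw'), eisTwo_add_int _ hw', eisTwo_add_int _ hz,
      eisTwo_add_int _ h3, eisTwo_mobius hz, eisTwo_mobius h3, eisTwo_mobius hw,
      eisTwo_neg_inv hw']
    push_cast
    ring
  have hD : etaProd (z / (2 * z + 1)) = 1 / 9 * (2 * z + 1) ^ 4 * etaProd ((z - 1) / 3) := by
    have hω := etaMult_ne_zero
    rw [etaProd, etaProd, p2, p3, p6, p1, w2, w3, w6, etaSq_add_int, etaSq_add_int, etaSq_add_int,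
      etaSq_add_int, etaSq_add_int, etaSq_mobius hz, etaSq_mobius h3, etaSq_mobius hw,
      etaSq_neg_inv hw', hv]
    simp only [zpow_neg, zpow_ofNat, Int.cast_one, Int.cast_ofNat]
    field_simp
    rw [etaMult_pow_three]
    linear_combination (-9 * etaSq z * etaSq (2 * z) * etaSq ((z - 1) / 3) *
      etaSq ((2 * z + 1) / 3)) * Complex.I_sq
  rw [FC_of_numer_etaProd hu hN hD]
  norm_num

end Transformation

/-! ### Cusp widths and coset representatives -/

/-- The lower left entry of γ Tᵐ γ⁻¹ is -c²m, where c is that of γ. Membership in Γ₀(6) sees only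
this entry modulo 6, so the sign ± is immaterial. -/
lemma cuspWidth_eq {γ : SL(2, ℤ)} {h : ℕ} (hpos : 0 < h)
    (hdvd : ∀ m : ℕ, (6 : ℤ) ∣ γ 1 0 ^ 2 * m ↔ h ∣ m) :
    cuspWidth (CongruenceSubgroup.Gamma0 6) γ = h := by
  have entry : ∀ m : ℕ, (γ * ModularGroup.T ^ m * γ⁻¹) 1 0 = -(γ 1 0 ^ 2 * m) := fun m => by
    rw [← zpow_natCast]
    simp only [Matrix.SpecialLinearGroup.coe_mul, ModularGroup.coe_T_zpow,
      Matrix.SpecialLinearGroup.coe_inv, Matrix.adjugate_fin_two, Matrix.mul_apply,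
      Fin.sum_univ_two]
    simp
    ring
  have key : ∀ m : ℕ, (γ * ModularGroup.T ^ m * γ⁻¹ ∈ CongruenceSubgroup.Gamma0 6 ∨
      -(γ * ModularGroup.T ^ m * γ⁻¹) ∈ CongruenceSubgroup.Gamma0 6) ↔ h ∣ m := fun m => by
    rw [CongruenceSubgroup.Gamma0_mem, CongruenceSubgroup.Gamma0_mem, Matrix.SpecialLinearGroup.coe_neg,
      Matrix.neg_apply, entry, neg_neg, Int.cast_neg, neg_eq_zero, or_self, ← hdvd]
    exact ZMod.intCast_zmod_eq_zero_iff_dvd _ 6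
  have hset : {m : ℕ | 0 < m ∧ (γ * ModularGroup.T ^ m * γ⁻¹ ∈ CongruenceSubgroup.Gamma0 6 ∨
      -(γ * ModularGroup.T ^ m * γ⁻¹) ∈ CongruenceSubgroup.Gamma0 6)} = {m | 0 < m ∧ h ∣ m} := by
    ext m
    rw [Set.mem_ofPred_eq, Set.mem_ofPred_eq, key]
  rw [cuspWidth, hset]
  refine le_antisymm (Nat.sInf_le ⟨hpos, dvd_rfl⟩) ?_
  exact le_csInf ⟨h, hpos, dvd_rfl⟩ fun m hm => Nat.le_of_dvd hm.1 hm.2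

lemma mul_T_pow_apply (γ : SL(2, ℤ)) (n : ℕ) (i : Fin 2) :
    (γ * ModularGroup.T ^ n) i 0 = γ i 0 ∧
      (γ * ModularGroup.T ^ n) i 1 = γ i 0 * n + γ i 1 := by
  rw [← zpow_natCast]
  simp only [Matrix.SpecialLinearGroup.coe_mul, ModularGroup.coe_T_zpow, Matrix.mul_apply,
    Fin.sum_univ_two]
  simp

lemma FC_cosetReps {γ : SL(2, ℤ)} (hγ : γ ∈ cosetReps) {h : ℕ}
    (hh : h = cuspWidth (CongruenceSubgroup.Gamma0 6) γ) :
    ∃ (κ : ℂ) (r : ℤ), κ ^ 2 = 1 ∧ 0 < h ∧ h ∣ 6 ∧ ∀ z : ℂ, 0 < z.im →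
      FC ((γ 0 0 * z + γ 0 1) / (γ 1 0 * z + γ 1 1)) * (γ 1 0 * z + γ 1 1) ^ 2 =
        κ * h * FC ((z + r) / h) := by
  rcases hγ with rfl | ⟨r, -, rfl⟩ | ⟨s, -, rfl⟩ | ⟨t, -, rfl⟩
  · have hw : h = 1 := hh.trans (cuspWidth_eq one_pos fun m => by simp)
    subst hw
    exact ⟨1, 0, by simp, by simp, by simp, fun z _ => by simp⟩
  · have hw : h = 2 := hh.trans (cuspWidth_eq two_pos fun m => by
      rw [(mul_T_pow_apply _ _ _).1]
      simp only [gammaThird, Matrix.of_apply, Matrix.cons_val]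
      omega)
    subst hw
    refine ⟨-1, r + 1, by simp, by simp, by norm_num, fun z hz => ?_⟩
    have := FC_mobius_three (z := z + r) (by simpa using hz)
    simp only [(mul_T_pow_apply _ _ _).1, (mul_T_pow_apply _ _ _).2]
    simp only [gammaThird, Matrix.of_apply, Matrix.cons_val]
    push_cast
    convert this using 3 <;> ring
  · have hw : h = 3 := hh.trans (cuspWidth_eq three_pos fun m => by
      rw [(mul_T_pow_apply _ _ _).1]
      simp only [gammaHalf, Matrix.of_apply, Matrix.cons_val]
      omega)
    subst hw
    refine ⟨-1, s, by simp, by simp, by norm_num, fun z hz => ?_⟩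
    -- The extra 1 appears because `gammaHalf` is the matrix with rows (1, 0), (2, 1) times T.
    have := FC_mobius_two (z := z + s + 1) (by simpa using hz)
    simp only [(mul_T_pow_apply _ _ _).1, (mul_T_pow_apply _ _ _).2]
    simp only [gammaHalf, Matrix.of_apply, Matrix.cons_val]
    push_cast
    convert this using 3 <;> ring
  · have hw : h = 6 := hh.trans (cuspWidth_eq (by norm_num) fun m => by
      rw [(mul_T_pow_apply _ _ _).1]
      simp only [gammaZero, Matrix.of_apply, Matrix.cons_val]
      omega)
    subst hw
    refine ⟨1, t, by simp, by simp, by norm_num, fun z hz => ?_⟩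
    have := FC_neg_inv (z := z + t) (by simpa using hz)
    simp only [(mul_T_pow_apply _ _ _).1, (mul_T_pow_apply _ _ _).2]
    simp only [gammaZero, Matrix.of_apply, Matrix.cons_val]
    push_cast
    convert this using 3 <;> ring

/-! ### The function `P` -/

/-- `P` as a function on `ℂ`. -/
def PC (z : ℂ) : ℂ :=
  -(1 / (2 * Real.pi * Complex.I) * deriv FC z + 1 / (2 * Real.pi * z.im) * FC z)

lemma P_eq_PC (hFC : DifferentiableOn ℂ FC {z | 0 < z.im}) (τ : ℍ) : P τ = PC τ := by
  have hopen : IsOpen {z : ℂ | 0 < z.im} := isOpen_lt continuous_const Complex.continuous_im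
  have hmem : {z : ℂ | 0 < z.im} ∈ nhds (τ : ℂ) := hopen.mem_nhds τ.im_pos
  have heq : F ∘ ofComplex =ᶠ[nhds (τ : ℂ)] FC := by
    filter_upwards [hmem] with z hz
    rw [Function.comp, F_eq_FC, ofComplex_apply_of_im_pos hz]
  have hd : HasDerivAt (F ∘ ofComplex) (deriv FC τ) τ :=
    ((hFC.differentiableAt hmem).hasDerivAt).congr_of_eventuallyEq heq
  have hf := (hd.hasFDerivAt.restrictScalars ℝ).fderiv
  have hw : wirtinger F τ = deriv FC τ := by
    rw [wirtinger, hf]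
    simp
    ring_nf
    rw [Complex.I_sq]
    ring
  rw [P, raising, hw, PC, F_eq_FC]
  push_cast
  have hv : (τ.im : ℂ) ≠ 0 := by exact_mod_cast τ.im_pos.ne'
  have hpi : (Real.pi : ℂ) ≠ 0 := by exact_mod_cast Real.pi_ne_zero
  rw [coe_im]
  field_simp
  ring

/-- Differentiating the weight -2 law produces an extra term 2c(cz + d)F; the change of 1/Im z under
the Möbius map cancels it exactly, leaving weight 0. -/
lemma PC_of_FC (hFC : DifferentiableOn ℂ FC {z | 0 < z.im}) {a b c d h r : ℝ} {κ : ℂ}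
    (hdet : a * d - b * c = 1) (hh : 0 < h)
    (H : ∀ z : ℂ, 0 < z.im → FC ((a * z + b) / (c * z + d)) * (c * z + d) ^ 2 =
      κ * h * FC ((z + r) / h)) {z : ℂ} (hz : 0 < z.im) :
    PC ((a * z + b) / (c * z + d)) = κ * PC ((z + r) / h) := by
  have hopen : IsOpen {z : ℂ | 0 < z.im} := isOpen_lt continuous_const Complex.continuous_im
  have hu : (c * z + d : ℂ) ≠ 0 := by
    intro h0
    have him : c * z.im = 0 := by simpa using congrArg Complex.im h0
    have hre : c * z.re + d = 0 := by simpa using congrArg Complex.re h0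
    have hc : c = 0 := (mul_eq_zero.mp him).resolve_right hz.ne'
    have hd : d = 0 := by simpa [hc] using hre
    simp [hc, hd] at hdet
  have him : ((a * z + b) / (c * z + d) : ℂ).im = z.im / Complex.normSq (c * z + d) := by
    rw [Complex.div_im, ← sub_div]
    congr 1
    simp
    linear_combination z.im * hdet
  have hns : 0 < Complex.normSq (c * z + d) := Complex.normSq_pos.mpr hu
  have hmim : 0 < ((a * z + b) / (c * z + d) : ℂ).im := by rw [him]; positivity
  have hwim : ((z + r) / h : ℂ).im = z.im / h := by rw [Complex.div_ofReal_im]; simp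
  have hwim' : 0 < ((z + r) / h : ℂ).im := by rw [hwim]; positivity
  have hhC : (h : ℂ) ≠ 0 := by exact_mod_cast hh.ne'
  have hdetC : (a * d - b * c : ℂ) = 1 := by exact_mod_cast hdet
  have hm : HasDerivAt (fun z : ℂ => (a * z + b) / (c * z + d)) (1 / (c * z + d : ℂ) ^ 2) z := by
    have h1 : HasDerivAt (fun z : ℂ => a * z + b) (a : ℂ) z := by
      simpa using ((hasDerivAt_id z).const_mul (a : ℂ)).add_const (b : ℂ)
    have h2 : HasDerivAt (fun z : ℂ => c * z + d) (c : ℂ) z := by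
      simpa using ((hasDerivAt_id z).const_mul (c : ℂ)).add_const (d : ℂ)
    refine (h1.div h2 hu).congr_deriv ?_
    congr 1
    linear_combination hdetC
  have hsq : HasDerivAt (fun z : ℂ => (c * z + d : ℂ) ^ 2) (2 * c * (c * z + d)) z := by
    have h2 : HasDerivAt (fun z : ℂ => c * z + d) (c : ℂ) z := by
      simpa using ((hasDerivAt_id z).const_mul (c : ℂ)).add_const (d : ℂ)
    exact (h2.pow 2).congr_deriv (by norm_num; ring)
  have hw : HasDerivAt (fun z : ℂ => (z + r) / h) (1 / h : ℂ) z :=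
    ((hasDerivAt_id z).add_const (r : ℂ)).div_const (h : ℂ)
  have hF1 := ((hFC.differentiableAt (hopen.mem_nhds hmim)).hasDerivAt).comp z hm
  have hF2 := ((hFC.differentiableAt (hopen.mem_nhds hwim')).hasDerivAt).comp z hw
  have hL := hF1.mul hsq
  have hR := hF2.const_mul (κ * h)
  have hLR := hL.unique (hR.congr_of_eventuallyEq (by
    filter_upwards [hopen.mem_nhds hz] with y hy using H y hy))
  have hz0 := H z hz
  simp only [Function.comp] at hLR
  have hv : (z.im : ℂ) ≠ 0 := by exact_mod_cast hz.ne'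
  have hpi : (Real.pi : ℂ) ≠ 0 := by exact_mod_cast Real.pi_ne_zero
  have hI := Complex.I_ne_zero
  rw [PC, PC, him, hwim]
  set A := deriv FC ((a * z + b) / (c * z + d))
  set B := deriv FC ((z + r) / h)
  set f := FC ((a * z + b) / (c * z + d))
  set g := FC ((z + r) / h)
  -- The conjugate of z is written as z - 2i Im z, so that the final identity is algebraic in z and
  -- Im z.
  have hN : (Complex.normSq (c * z + d) : ℂ) = (c * z + d) * (c * z + d - 2 * Complex.I * c * z.im) := by
    rw [← Complex.mul_conj]
    congr 1
    apply Complex.ext <;> simp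
    ring
  push_cast
  rw [hN]
  have hN0 : (c * z + d : ℂ) * (c * z + d - 2 * Complex.I * c * z.im) ≠ 0 := by
    rw [← hN]; exact_mod_cast hns.ne'
  have hA : A = κ * B - 2 * c * (c * z + d) * f := by
    have : A * (1 / (c * z + d : ℂ) ^ 2) * (c * z + d) ^ 2 = A := by field_simp
    rw [this] at hLR
    have : κ * h * (B * (1 / h)) = κ * B := by field_simp
    rw [this] at hLR
    linear_combination hLR
  rw [hA]
  field_simp
  linear_combination -Complex.I * hz0 + 2 * c * (c * z + d) * f * z.im * Complex.I_sq

section QExpansion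

/-! ### Power series representing functions on the unit disc -/

open PowerSeries Finset

/-- The power series `p` converges to `g` on the open unit disc. -/
def Represents (p : PowerSeries ℝ) (g : ℂ → ℂ) : Prop :=
  ∀ q : ℂ, ‖q‖ < 1 → HasSum (fun n => ((coeff n p : ℝ) : ℂ) * q ^ n) (g q)

lemma hasSum_of_eq {f g : ℕ → ℂ} {a : ℂ} (hg : HasSum g a) (h : ∀ n, f n = g n) : HasSum f a :=
  (funext h : f = g) ▸ hg

lemma Represents.mul {p₁ p₂ : PowerSeries ℝ} {g₁ g₂ : ℂ → ℂ} (h₁ : Represents p₁ g₁)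
    (h₂ : Represents p₂ g₂) : Represents (p₁ * p₂) (fun q => g₁ q * g₂ q) := by
  intro q hq
  have s₁ := (h₁ q hq).summable.norm
  have s₂ := (h₂ q hq).summable.norm
  have hs := (summable_norm_sum_mul_antidiagonal_of_summable_norm s₁ s₂).of_norm.hasSum
  rw [← tsum_mul_tsum_eq_tsum_sum_antidiagonal_of_summable_norm s₁ s₂, (h₁ q hq).tsum_eq,
    (h₂ q hq).tsum_eq] at hs
  refine hasSum_of_eq hs fun n => ?_
  rw [coeff_mul]
  push_cast
  rw [Finset.sum_mul]
  refine Finset.sum_congr rfl fun x hx => ?_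
  rw [← mem_antidiagonal.mp hx, pow_add]
  ring

lemma represents_one : Represents 1 (fun _ => 1) := by
  intro q _
  have := hasSum_ite_eq (0 : ℕ) (1 : ℂ)
  convert this using 2 with n
  rw [coeff_one]
  split_ifs with h <;> simp [h]

lemma Represents.prod {ι : Type*} {p : ι → PowerSeries ℝ} {g : ι → ℂ → ℂ} (s : Finset ι)
    (h : ∀ i ∈ s, Represents (p i) (g i)) :
    Represents (∏ i ∈ s, p i) (fun q => ∏ i ∈ s, g i q) := by
  classical
  induction s using Finset.induction_on with
  | empty => simpa using represents_one
  | insert a s ha ih =>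
    simp only [Finset.prod_insert ha]
    exact (h a (by simp)).mul (ih fun i hi => h i (by simp [hi]))

/-- The power series `1 / (1 - X ^ l)`. -/
def geomSeries (l : ℕ) : PowerSeries ℝ := PowerSeries.mk fun n => if l ∣ n then 1 else 0

lemma hasSum_dvd {f : ℕ → ℂ} {q s : ℂ} {l : ℕ} (hl : 0 < l)
    (h : HasSum (fun n => f n * (q ^ l) ^ n) s) :
    HasSum (fun n => (if l ∣ n then f (n / l) else 0) * q ^ n) s := by
  have hinj : Function.Injective (fun n : ℕ => l * n) := fun a b hab =>
    Nat.eq_of_mul_eq_mul_left hl hab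
  refine (hinj.hasSum_iff fun n hn => ?_).mp ?_
  · have : ¬ l ∣ n := fun ⟨m, hm⟩ => hn ⟨m, hm.symm⟩
    simp [this]
  · convert h using 2 with n
    simp [Nat.mul_div_cancel_left _ hl, pow_mul]

lemma represents_geomSeries {l : ℕ} (hl : 0 < l) :
    Represents (geomSeries l) (fun q => (1 - q ^ l)⁻¹) := by
  intro q hq
  have hq' : ‖q ^ l‖ < 1 := by
    rw [norm_pow]; exact pow_lt_one₀ (norm_nonneg _) hq hl.ne'
  have := hasSum_dvd (f := fun _ => 1) (q := q) hl (by simpa using hasSum_geometric_of_norm_lt_one hq')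
  convert this using 2 with n
  rw [geomSeries, coeff_mk]
  split_ifs <;> simp

lemma geomSeries_eq {l : ℕ} (hl : 0 < l) : geomSeries l = 1 + X ^ l * geomSeries l := by
  ext n
  simp only [geomSeries, coeff_mk, map_add, coeff_one, coeff_X_pow_mul']
  rcases Nat.eq_zero_or_pos n with rfl | hn
  · simp [hl.ne']
  · by_cases hln : l ≤ n
    · have h : l ∣ n - l ↔ l ∣ n := by
        obtain ⟨m, rfl⟩ := Nat.exists_eq_add_of_le hln
        simp
      simp [hln, hn.ne', h]
    · have : ¬ l ∣ n := fun h => hln (Nat.le_of_dvd hn h)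
      simp [hln, hn.ne', this]

/-! ### Finite products of geometric series -/

section Products

variable {ι : Type*} (l : ι → ℕ)

/-- The finite product of the series `1 / (1 - X ^ (l i))`. -/
def geomProd (s : Finset ι) : PowerSeries ℝ := ∏ i ∈ s, geomSeries (l i)

lemma coeff_mul_nonneg {p₁ p₂ : PowerSeries ℝ} (h₁ : ∀ n, 0 ≤ coeff n p₁)
    (h₂ : ∀ n, 0 ≤ coeff n p₂) (n : ℕ) : 0 ≤ coeff n (p₁ * p₂) := by
  rw [coeff_mul]
  exact Finset.sum_nonneg fun x _ => mul_nonneg (h₁ _) (h₂ _)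

lemma coeff_geomSeries_nonneg (k n : ℕ) : 0 ≤ coeff n (geomSeries k) := by
  rw [geomSeries, coeff_mk]
  split_ifs <;> norm_num

lemma coeff_X_pow_nonneg (k n : ℕ) : 0 ≤ coeff n (X ^ k : PowerSeries ℝ) := by
  rw [coeff_X_pow]
  split_ifs <;> norm_num

lemma coeff_geomProd_nonneg (s : Finset ι) (n : ℕ) : 0 ≤ coeff n (geomProd l s) := by
  classical
  induction s using Finset.induction_on generalizing n with
  | empty =>
    rw [geomProd, Finset.prod_empty, coeff_one]
    split_ifs <;> norm_num
  | insert a s ha ih =>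
    rw [geomProd, Finset.prod_insert ha]
    exact coeff_mul_nonneg (coeff_geomSeries_nonneg _) ih n

variable {l}

lemma geomProd_insert [DecidableEq ι] (hl : ∀ i, 0 < l i) {a : ι} {s : Finset ι} (ha : a ∉ s) :
    geomProd l (insert a s) = geomProd l s + X ^ l a * geomProd l (insert a s) := by
  have h : geomProd l (insert a s) = geomSeries (l a) * geomProd l s := Finset.prod_insert ha
  rw [h]
  conv_lhs => rw [geomSeries_eq (hl a)]
  ring

lemma coeff_geomProd_le_insert [DecidableEq ι] (hl : ∀ i, 0 < l i) {a : ι} {s : Finset ι}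
    (ha : a ∉ s) (n : ℕ) : coeff n (geomProd l s) ≤ coeff n (geomProd l (insert a s)) := by
  rw [geomProd_insert hl ha, map_add]
  exact le_add_of_nonneg_right
    (coeff_mul_nonneg (coeff_X_pow_nonneg _) (coeff_geomProd_nonneg l _) n)

/-- Removing one factor `X ^ (l i)` from each nonconstant monomial. -/
lemma coeff_geomProd_sub_one_le (hl : ∀ i, 0 < l i) (s : Finset ι) (n : ℕ) :
    coeff n (geomProd l s - 1) ≤ coeff n ((∑ i ∈ s, X ^ l i) * geomProd l s) := by
  classical
  induction s using Finset.induction_on generalizing n with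
  | empty => simp [geomProd]
  | insert a s ha ih =>
    have h1 : geomProd l (insert a s) - 1 =
        (geomProd l s - 1) + X ^ l a * geomProd l (insert a s) := by
      nth_rw 1 [geomProd_insert hl ha]; ring
    rw [h1, Finset.sum_insert ha, add_mul, map_add, map_add, add_comm]
    refine add_le_add_right ((ih n).trans ?_) _
    rw [coeff_mul, coeff_mul]
    refine Finset.sum_le_sum fun x _ => mul_le_mul_of_nonneg_left
      (coeff_geomProd_le_insert hl ha _) ?_
    rw [map_sum]
    exact Finset.sum_nonneg fun i _ => coeff_X_pow_nonneg _ _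

lemma coeff_geomProd_mono (hl : ∀ i, 0 < l i) {s t : Finset ι} (hst : s ⊆ t) (n : ℕ) :
    coeff n (geomProd l s) ≤ coeff n (geomProd l t) := by
  classical
  have key : ∀ u : Finset ι, Disjoint u s →
      coeff n (geomProd l s) ≤ coeff n (geomProd l (u ∪ s)) := by
    intro u
    induction u using Finset.induction_on with
    | empty => simp
    | insert a u ha ih =>
      intro hd
      rw [Finset.disjoint_insert_left] at hd
      have hau : a ∉ u ∪ s := by simp [ha, hd.1]
      rw [Finset.insert_union]
      exact (ih hd.2).trans (coeff_geomProd_le_insert hl hau n)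
  have := key (t \ s) Finset.sdiff_disjoint
  rwa [Finset.sdiff_union_of_subset hst] at this

/-- A factor 1/(1 - X^l) with l > n is 1 up to degree n. Hence each coefficient of the infinite
product can be read off a finite one. -/
lemma coeff_geomProd_stable (hl : ∀ i, 0 < l i) {s t : Finset ι} (hst : s ⊆ t) {n : ℕ}
    (h : ∀ i ∈ t, i ∉ s → n < l i) : coeff n (geomProd l t) = coeff n (geomProd l s) := by
  classical
  have key : ∀ u : Finset ι, Disjoint u s → (∀ i ∈ u, n < l i) →
      coeff n (geomProd l (u ∪ s)) = coeff n (geomProd l s) := by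
    intro u
    induction u using Finset.induction_on with
    | empty => simp
    | insert a u ha ih =>
      intro hd hu
      rw [Finset.disjoint_insert_left] at hd
      have hau : a ∉ u ∪ s := by simp [ha, hd.1]
      rw [Finset.insert_union, geomProd_insert hl hau, map_add, coeff_X_pow_mul',
        if_neg (not_le.mpr (hu a (by simp))), add_zero]
      exact ih hd.2 fun i hi => hu i (by simp [hi])
  have := key (t \ s) Finset.sdiff_disjoint fun i hi =>
    h i (Finset.mem_sdiff.mp hi).1 (Finset.mem_sdiff.mp hi).2
  rwa [Finset.sdiff_union_of_subset hst] at this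

end Products

/-- A pointwise limit of functions represented by power series with nonnegative and eventually
constant coefficients, bounded by the limit ones, is represented by the limit series. -/
lemma Represents.limit {p : ℕ → PowerSeries ℝ} {P : PowerSeries ℝ} {g : ℕ → ℂ → ℂ} {G : ℂ → ℂ}
    (hp : ∀ M, Represents (p M) (g M)) (h0 : ∀ M n, 0 ≤ coeff n (p M))
    (hle : ∀ M n, coeff n (p M) ≤ coeff n P) (hst : ∀ M n, n ≤ M → coeff n (p M) = coeff n P)
    (hlim : ∀ q : ℂ, ‖q‖ < 1 → Filter.Tendsto (fun M => g M q) Filter.atTop (nhds (G q))) :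
    Represents P G := by
  intro q hq
  have hP0 : ∀ n, 0 ≤ coeff n P := fun n => (h0 0 n).trans (hle 0 n)
  have hqn : ‖((‖q‖ : ℝ) : ℂ)‖ < 1 := by simpa using hq
  have hsum : Summable fun n => coeff n P * ‖q‖ ^ n := by
    -- At the nonnegative real point ‖q‖ the N-th partial sum for P agrees with that for p M once M
    -- ≥ N, so it is at most g M there; then M → ∞. The resulting series dominates the interchange
    -- of limit and sum.
    have hb : ∀ N, ∑ n ∈ range N, coeff n P * ‖q‖ ^ n ≤ ‖G (‖q‖ : ℝ)‖ := fun N => by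
      refine ge_of_tendsto (hlim _ hqn).norm ?_
      filter_upwards [Filter.eventually_ge_atTop N] with M hM
      have hs := hp M _ hqn
      have hre : HasSum (fun n => coeff n (p M) * ‖q‖ ^ n) (g M (‖q‖ : ℝ)).re := by
        have := Complex.hasSum_re hs
        convert this using 2 with n
        norm_cast
      have h1 : ∑ n ∈ range N, coeff n P * ‖q‖ ^ n = ∑ n ∈ range N, coeff n (p M) * ‖q‖ ^ n :=
        Finset.sum_congr rfl fun n hn => by
          rw [hst M n ((Finset.mem_range.mp hn).le.trans hM)]
      rw [h1]
      exact (sum_le_hasSum _ (fun n _ => mul_nonneg (h0 M n) (by positivity)) hre).trans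
        (Complex.re_le_norm _)
    exact summable_of_sum_range_le (fun n => mul_nonneg (hP0 n) (by positivity)) hb
  have hsumC : Summable fun n => ((coeff n P : ℝ) : ℂ) * q ^ n := by
    refine Summable.of_norm (hsum.congr fun n => ?_)
    simp [abs_of_nonneg (hP0 n)]
  have ht : Filter.Tendsto (fun M => ∑' n, ((coeff n (p M) : ℝ) : ℂ) * q ^ n) Filter.atTop
      (nhds (∑' n, ((coeff n P : ℝ) : ℂ) * q ^ n)) := by
    refine tendsto_tsum_of_dominated_convergence hsum (fun n => ?_) (.of_forall fun M n => ?_)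
    · refine tendsto_const_nhds.congr' ?_
      filter_upwards [Filter.eventually_ge_atTop n] with M hM
      rw [hst M n hM]
    · rw [norm_mul, norm_pow, Complex.norm_real, Real.norm_of_nonneg (h0 M n)]
      exact mul_le_mul_of_nonneg_right (hle M n) (by positivity)
  have hG := tendsto_nhds_unique ht ((hlim q hq).congr fun M => ((hp M q hq).tsum_eq).symm)
  rw [← hG]
  exact hsumC.hasSum

/-! ### The `q`-expansion of `F` -/

/-- The levels of the eta functions, with multiplicity. -/
def etaLevel : Fin 8 → ℕ := ![1, 1, 2, 2, 3, 3, 6, 6]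

/-- The exponents of the factors of the eta product. -/
def etaExp (i : ℕ × Fin 8) : ℕ := (i.1 + 1) * etaLevel i.2

lemma etaLevel_pos (j : Fin 8) : 0 < etaLevel j := by
  fin_cases j <;> simp [etaLevel]

lemma etaExp_pos (i : ℕ × Fin 8) : 0 < etaExp i :=
  Nat.mul_pos i.1.succ_pos (etaLevel_pos _)

/-- The index set of the first `M` factors of each eta function. -/
def etaIndex (M : ℕ) : Finset (ℕ × Fin 8) := range M ×ˢ univ

lemma etaIndex_mono {M N : ℕ} (h : M ≤ N) : etaIndex M ⊆ etaIndex N :=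
  Finset.product_subset_product_left (Finset.range_subset_range.mpr h)

lemma lt_etaExp {M n : ℕ} (hn : n ≤ M) {i : ℕ × Fin 8} (hi : i ∉ etaIndex M) : n < etaExp i := by
  have h1 : M ≤ i.1 := by simpa [etaIndex] using hi
  calc n < i.1 + 1 := by omega
    _ ≤ etaExp i := Nat.le_mul_of_pos_right _ (etaLevel_pos _)

/-- The power series of `q / (η(τ) η(2τ) η(3τ) η(6τ)) ^ 2`. -/
def etaSeries : PowerSeries ℝ := PowerSeries.mk fun n => coeff n (geomProd etaExp (etaIndex n))

lemma coeff_geomProd_etaIndex {M n : ℕ} (hn : n ≤ M) :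
    coeff n (geomProd etaExp (etaIndex M)) = coeff n etaSeries := by
  rw [etaSeries, coeff_mk]
  exact coeff_geomProd_stable etaExp_pos (etaIndex_mono hn) fun i _ hi => lt_etaExp le_rfl hi

lemma coeff_geomProd_etaIndex_le (M n : ℕ) :
    coeff n (geomProd etaExp (etaIndex M)) ≤ coeff n etaSeries := by
  rw [← coeff_geomProd_etaIndex (le_max_right M n)]
  exact coeff_geomProd_mono etaExp_pos (etaIndex_mono (le_max_left M n)) n

lemma coeff_etaSeries_nonneg (n : ℕ) : 0 ≤ coeff n etaSeries := by
  rw [etaSeries, coeff_mk]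
  exact coeff_geomProd_nonneg _ _ _

lemma coeff_zero_etaSeries : coeff 0 etaSeries = 1 := by
  simp [etaSeries, etaIndex, geomProd]

/-! ### The eta product in the denominator. -/

/-- Euler's product `∏ (1 - q ^ n)`. -/
def eulerProd (q : ℂ) : ℂ := ∏' n : ℕ, (1 - q ^ (n + 1))

lemma eulerProd_ne_zero {q : ℂ} (hq : ‖q‖ < 1) : eulerProd q ≠ 0 := by
  have hs : Summable fun n : ℕ => ‖-q ^ (n + 1)‖ := by
    simpa using (summable_nat_add_iff 1).mpr (summable_geometric_of_lt_one (norm_nonneg q) hq)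
  have := tprod_one_add_ne_zero_of_summable (f := fun n : ℕ => -q ^ (n + 1)) (fun n h => ?_) hs
  · simpa [eulerProd, sub_eq_add_neg] using this
  · have h1 : q ^ (n + 1) = 1 := by linear_combination -h
    have h2 : ‖q ^ (n + 1)‖ < 1 := by
      rw [norm_pow]; exact pow_lt_one₀ (norm_nonneg _) hq n.succ_ne_zero
    rw [h1] at h2
    simp at h2

lemma tendsto_eulerProd {q : ℂ} (hq : ‖q‖ < 1) :
    Filter.Tendsto (fun M => ∏ n ∈ range M, (1 - q ^ (n + 1))) Filter.atTop
      (nhds (eulerProd q)) :=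
  (ModularForm.multipliable_one_sub_pow hq).hasProd.tendsto_prod_nat

/-- The function represented by `etaSeries`. -/
def etaFun (q : ℂ) : ℂ :=
  (eulerProd q ^ 2 * eulerProd (q ^ 2) ^ 2 * eulerProd (q ^ 3) ^ 2 * eulerProd (q ^ 6) ^ 2)⁻¹

lemma norm_pow_lt_one {q : ℂ} (hq : ‖q‖ < 1) {k : ℕ} (hk : k ≠ 0) : ‖q ^ k‖ < 1 := by
  rw [norm_pow]; exact pow_lt_one₀ (norm_nonneg _) hq hk

lemma represents_etaSeries : Represents etaSeries etaFun := by
  refine Represents.limit (p := fun M => geomProd etaExp (etaIndex M))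
    (g := fun M q => ∏ i ∈ etaIndex M, (1 - q ^ etaExp i)⁻¹)
    (fun M => Represents.prod _ fun i _ => represents_geomSeries (etaExp_pos i))
    (fun M => coeff_geomProd_nonneg _ _) coeff_geomProd_etaIndex_le
    (fun M n hn => coeff_geomProd_etaIndex hn) fun q hq => ?_
  have h2 := norm_pow_lt_one hq two_ne_zero
  have h3 := norm_pow_lt_one hq three_ne_zero
  have h6 := norm_pow_lt_one hq (k := 6) (by norm_num)
  have hlim := (((((tendsto_eulerProd hq).pow 2).mul ((tendsto_eulerProd h2).pow 2)).mul
    ((tendsto_eulerProd h3).pow 2)).mul ((tendsto_eulerProd h6).pow 2)).inv₀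
    (by simp [eulerProd_ne_zero hq, eulerProd_ne_zero h2, eulerProd_ne_zero h3,
      eulerProd_ne_zero h6])
  refine hlim.congr fun M => ?_
  simp only [etaIndex, Finset.prod_product, Fin.prod_univ_eight, etaExp, etaLevel,
    Finset.prod_inv_distrib, Finset.prod_mul_distrib, ← pow_mul, mul_one, Matrix.cons_val]
  simp only [mul_comm 2, mul_comm 3, mul_comm 6, mul_inv_rev, ← inv_pow]
  ring

/-! ### The Eisenstein numerator and the power series of q F. -/

/-- The sum of the divisors of `n` which are prime to `6`. -/
def sigmaSix (n : ℕ) : ℝ := ∑ d ∈ n.divisors with ¬ 2 ∣ d ∧ ¬ 3 ∣ d, (d : ℝ)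

lemma one_le_sigmaSix {n : ℕ} (hn : n ≠ 0) : 1 ≤ sigmaSix n := by
  have : (1 : ℕ) ∈ n.divisors.filter fun d => ¬ 2 ∣ d ∧ ¬ 3 ∣ d := by simp [hn]
  simpa [sigmaSix] using Finset.single_le_sum (f := fun d : ℕ => (d : ℝ))
    (fun d _ => Nat.cast_nonneg d) this

/-- The divisors of n divisible by k are k times the divisors of n/k. -/
lemma mul_sigma_div {n k : ℕ} (hn : n ≠ 0) (hk : k ≠ 0) :
    (if k ∣ n then k * (ArithmeticFunction.sigma 1 (n / k) : ℝ) else 0) =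
      ∑ d ∈ n.divisors, if k ∣ d then (d : ℝ) else 0 := by
  rw [← Finset.sum_filter]
  split_ifs with h
  · obtain ⟨m, rfl⟩ := h
    have hm : m ≠ 0 := right_ne_zero_of_mul hn
    rw [Nat.mul_div_cancel_left _ (Nat.pos_of_ne_zero hk), ArithmeticFunction.sigma_one_apply]
    push_cast
    rw [Finset.mul_sum]
    refine Finset.sum_nbij (fun d => k * d) (fun d hd => ?_) (fun a _ b _ hab => ?_)
      (fun d hd => ?_) (fun d _ => by push_cast; rfl)
    · have := (Nat.mem_divisors.mp hd).1
      simp [hn, mul_dvd_mul_left k this]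
    · exact Nat.eq_of_mul_eq_mul_left (Nat.pos_of_ne_zero hk) hab
    · have hd' : (d ∣ k * m ∧ k * m ≠ 0) ∧ k ∣ d := by
        simpa [Nat.mem_divisors] using hd
      obtain ⟨⟨h1, -⟩, e, rfl⟩ := hd'
      refine ⟨e, ?_, rfl⟩
      simpa [hm] using Nat.dvd_of_mul_dvd_mul_left (Nat.pos_of_ne_zero hk) h1
  · symm
    apply Finset.sum_eq_zero
    intro d hd
    have hd' := Finset.mem_filter.mp hd
    exact absurd (hd'.2.trans (Nat.dvd_of_mem_divisors hd'.1)) h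

/-- Inclusion–exclusion over divisibility by 2 and by 3. -/
lemma sigmaSix_eq {n : ℕ} (hn : n ≠ 0) :
    (ArithmeticFunction.sigma 1 n : ℝ) -
      (if 2 ∣ n then 2 * (ArithmeticFunction.sigma 1 (n / 2) : ℝ) else 0) -
      (if 3 ∣ n then 3 * (ArithmeticFunction.sigma 1 (n / 3) : ℝ) else 0) +
      (if 6 ∣ n then 6 * (ArithmeticFunction.sigma 1 (n / 6) : ℝ) else 0) = sigmaSix n := by
  have h1 := mul_sigma_div hn one_ne_zero
  have h2 := mul_sigma_div hn two_ne_zero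
  have h3 := mul_sigma_div hn three_ne_zero
  have h6 := mul_sigma_div hn (k := 6) (by norm_num)
  push_cast at h1 h2 h3 h6
  simp only [one_dvd, if_true, one_mul, Nat.div_one] at h1
  rw [h1, h2, h3, h6, sigmaSix, Finset.sum_filter, ← Finset.sum_sub_distrib,
    ← Finset.sum_sub_distrib, ← Finset.sum_add_distrib]
  refine Finset.sum_congr rfl fun d _ => ?_
  by_cases a : 2 ∣ d <;> by_cases b : 3 ∣ d
  · have : 6 ∣ d := by omega
    simp [a, b, this]
  all_goals
    have : ¬ 6 ∣ d := by omega
    simp [a, b, this]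

/-- The power series of half the numerator of `F`. -/
def numerSeries : PowerSeries ℝ :=
  PowerSeries.mk fun n => if n = 0 then 1 else -12 * sigmaSix n

/-- The variable `q = exp (2 π i z)`. -/
def nome (z : ℂ) : ℂ := Complex.exp (2 * Real.pi * Complex.I * z)

lemma norm_nome (z : ℂ) : ‖nome z‖ = Real.exp (-(2 * Real.pi * z.im)) := by
  rw [nome, Complex.norm_exp]
  congr 1
  simp [mul_assoc]

lemma norm_nome_lt_one {z : ℂ} (hz : 0 < z.im) : ‖nome z‖ < 1 := by
  rw [norm_nome, Real.exp_lt_one_iff]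
  have := Real.pi_pos
  have : 0 < 2 * Real.pi * z.im := by positivity
  linarith

lemma nome_nat_mul (k : ℕ) (z : ℂ) : nome (k * z) = nome z ^ k := by
  rw [nome, nome, ← Complex.exp_nat_mul]
  congr 1
  ring

lemma hasSum_eisTwo {z : ℂ} (hz : 0 < z.im) {k : ℕ} (hk : 0 < k) :
    HasSum (fun n => (if k ∣ n then (if n / k = 0 then 1 else
      -24 * (ArithmeticFunction.sigma 1 (n / k) : ℂ)) else 0) * nome z ^ n) (eisTwo (k * z)) := by
  have hkz : 0 < ((k : ℂ) * z).im := by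
    simpa using mul_pos (Nat.cast_pos.mpr hk) hz
  refine hasSum_dvd (f := fun n => if n = 0 then 1 else
    -24 * (ArithmeticFunction.sigma 1 n : ℂ)) hk ?_
  have := EisensteinSeries.hasSum_qExpansion_E2 ⟨k * z, hkz⟩
  rw [eisTwo, ofComplex_apply_of_im_pos hkz, ← nome_nat_mul]
  simpa only [smul_eq_mul] using! this

lemma hasSum_numer {z : ℂ} (hz : 0 < z.im) :
    HasSum (fun n => ((coeff n numerSeries : ℝ) : ℂ) * nome z ^ n) (numer z / 2) := by
  have h1 := hasSum_eisTwo hz one_pos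
  have h2 := (hasSum_eisTwo hz two_pos).mul_left 2
  have h3 := (hasSum_eisTwo hz three_pos).mul_left 3
  have h6 := (hasSum_eisTwo hz (k := 6) (by norm_num)).mul_left 6
  have := (((h1.sub h2).sub h3).add h6).div_const 2
  push_cast at this
  rw [one_mul] at this
  refine hasSum_of_eq this fun n => ?_
  rw [numerSeries, coeff_mk]
  by_cases hn : n = 0
  · subst hn
    norm_num
  · have e : ∀ k : ℕ, (if k ∣ n then (if n / k = 0 then 1 else
      -24 * (ArithmeticFunction.sigma 1 (n / k) : ℂ)) else 0) = if k ∣ n then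
      -24 * (ArithmeticFunction.sigma 1 (n / k) : ℂ) else 0 := fun k => by
        by_cases hkn : k ∣ n
        · have : n / k ≠ 0 := fun h0 => hn (by
            rw [← Nat.mul_div_cancel' hkn, h0, mul_zero])
          simp [this]
        · simp [hkn]
    have hs := congrArg (fun x : ℝ => (x : ℂ)) (sigmaSix_eq hn)
    rw [if_neg hn, e, e, e, e]
    push_cast at hs ⊢
    rw [← hs]
    simp only [one_dvd, if_true, Nat.div_one]
    split_ifs <;> push_cast <;> ring

/-- The power series of `q F`. -/
def FSeries : PowerSeries ℝ := numerSeries * etaSeries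

/-- The fractional powers of q combine to q because (1 + 2 + 3 + 6)/12 = 1. -/
lemma etaProd_eq (z : ℂ) : etaProd z = nome z * (etaFun (nome z))⁻¹ := by
  have h : ∀ k : ℕ, etaSq (k * z) =
      Complex.exp (2 * Real.pi * Complex.I * (k * z) / 12) * eulerProd (nome z ^ k) ^ 2 := fun k => by
    rw [etaSq, ModularForm.eta, mul_pow, ← nome_nat_mul]
    congr 1
    · rw [Function.Periodic.qParam, ← Complex.exp_nat_mul]
      congr 1
      push_cast
      ring
    · simp [eulerProd, ModularForm.eta_q, Function.Periodic.qParam, nome]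
  have h1 := h 1
  have h2 := h 2
  have h3 := h 3
  have h6 := h 6
  push_cast at h1 h2 h3 h6
  rw [one_mul, pow_one] at h1
  have hexp : Complex.exp (2 * Real.pi * Complex.I * z / 12) *
      Complex.exp (2 * Real.pi * Complex.I * (2 * z) / 12) *
      Complex.exp (2 * Real.pi * Complex.I * (3 * z) / 12) *
      Complex.exp (2 * Real.pi * Complex.I * (6 * z) / 12) = nome z := by
    rw [nome, ← Complex.exp_add, ← Complex.exp_add, ← Complex.exp_add]
    congr 1
    ring
  rw [etaProd, h1, h2, h3, h6, etaFun, inv_inv]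
  rw [← hexp]
  ring

lemma hasSum_FSeries {z : ℂ} (hz : 0 < z.im) :
    HasSum (fun n => ((coeff n FSeries : ℝ) : ℂ) * nome z ^ n) (nome z * FC z) := by
  have s₁ := (hasSum_numer hz).summable.norm
  have hr := represents_etaSeries _ (norm_nome_lt_one hz)
  have s₂ := hr.summable.norm
  have hs := (summable_norm_sum_mul_antidiagonal_of_summable_norm s₁ s₂).of_norm.hasSum
  rw [← tsum_mul_tsum_eq_tsum_sum_antidiagonal_of_summable_norm s₁ s₂, (hasSum_numer hz).tsum_eq,
    hr.tsum_eq] at hs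
  have e : nome z * FC z = numer z / 2 * etaFun (nome z) := by
    have : nome z ≠ 0 := Complex.exp_ne_zero _
    rw [FC, etaProd_eq]
    field_simp
  rw [e]
  refine hasSum_of_eq hs fun n => ?_
  rw [FSeries, coeff_mul]
  push_cast
  rw [Finset.sum_mul]
  refine Finset.sum_congr rfl fun x hx => ?_
  rw [← mem_antidiagonal.mp hx, pow_add]
  ring

/-! ### Signs of the coefficients of F. -/

/-- The negative of the coefficient of `q ^ n` in `F`. -/
def FCoeff (n : ℕ) : ℝ := -coeff (n + 1) FSeries

/-- Each of the eight Euler products, counted with multiplicity, has at most one factor of exponent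
k. -/
lemma coeff_sum_X_pow_le (M k : ℕ) :
    coeff k (∑ i ∈ etaIndex M, (X : PowerSeries ℝ) ^ etaExp i) ≤
      if k = 0 then 0 else 8 := by
  rw [map_sum]
  simp only [coeff_X_pow]
  split_ifs with hk
  · refine (Finset.sum_eq_zero fun i _ => ?_).le
    rw [if_neg]
    have := etaExp_pos i
    omega
  · rw [etaIndex, Finset.sum_product_right]
    calc ∑ j : Fin 8, ∑ m ∈ range M, (if k = etaExp (m, j) then (1 : ℝ) else 0)
        ≤ ∑ j : Fin 8, 1 := Finset.sum_le_sum fun j _ => ?_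
      _ = 8 := by simp
    rw [← Finset.sum_filter, Finset.sum_const, nsmul_one]
    have : (#{m ∈ range M | k = etaExp (m, j)}) ≤ 1 := by
      refine Finset.card_le_one.mpr fun a ha b hb => ?_
      have h := (Finset.mem_filter.mp ha).2.symm.trans (Finset.mem_filter.mp hb).2
      have := Nat.eq_of_mul_eq_mul_right (etaLevel_pos j) h
      omega
    exact_mod_cast this

lemma coeff_etaSeries_le (n : ℕ) : coeff (n + 1) etaSeries ≤
    ∑ x ∈ antidiagonal (n + 1), (if x.1 = 0 then 0 else 8) * coeff x.2 etaSeries := by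
  have h := coeff_geomProd_sub_one_le etaExp_pos (etaIndex (n + 1)) (n + 1)
  rw [map_sub, coeff_one, if_neg n.succ_ne_zero, sub_zero, coeff_geomProd_etaIndex le_rfl] at h
  refine h.trans ?_
  rw [coeff_mul]
  exact Finset.sum_le_sum fun x _ => mul_le_mul (coeff_sum_X_pow_le _ _)
    (coeff_geomProd_etaIndex_le _ _) (coeff_geomProd_nonneg _ _ _) (by split_ifs <;> norm_num)

/-- With e the coefficients of the eta quotient, c_n = 12 ∑_{k ≥ 1} σ(k) e(n+1-k) - e(n+1), where σ
is `sigmaSix`. By `coeff_etaSeries_le`, e(n+1) ≤ 8 ∑_{k ≥ 1} e(n+1-k), and 8 ≤ 12 σ(k). -/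
lemma FCoeff_nonneg (n : ℕ) : 0 ≤ FCoeff n := by
  have key : FCoeff n = ∑ x ∈ antidiagonal (n + 1),
      (if x.1 = 0 then -1 else 12 * sigmaSix x.1) * coeff x.2 etaSeries := by
    rw [FCoeff, FSeries, coeff_mul, ← Finset.sum_neg_distrib]
    refine Finset.sum_congr rfl fun x _ => ?_
    rw [numerSeries, coeff_mk]
    split_ifs <;> ring
  have h0 : ∑ x ∈ antidiagonal (n + 1), (if x.1 = 0 then (1 : ℝ) else 0) * coeff x.2 etaSeries =
      coeff (n + 1) etaSeries := by
    rw [Finset.Nat.sum_antidiagonal_succ]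
    simp
  have := coeff_etaSeries_le n
  rw [key]
  calc (0 : ℝ) ≤ ∑ x ∈ antidiagonal (n + 1), (if x.1 = 0 then 0 else 8) * coeff x.2 etaSeries -
      ∑ x ∈ antidiagonal (n + 1), (if x.1 = 0 then (1 : ℝ) else 0) * coeff x.2 etaSeries := by
        rw [h0]; linarith
    _ ≤ _ := by
      rw [← Finset.sum_sub_distrib]
      refine Finset.sum_le_sum fun x _ => ?_
      rw [← sub_mul]
      refine mul_le_mul_of_nonneg_right ?_ (coeff_etaSeries_nonneg _)
      split_ifs with hx
      · norm_num
      · linarith [one_le_sigmaSix hx]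

/-- Here c_0 = 12 - e(1), and e(1) ≥ 0 is enough. -/
lemma FCoeff_zero_le : FCoeff 0 ≤ 12 := by
  have h1 := coeff_etaSeries_nonneg 1
  have hs : sigmaSix 1 = 1 := by simp [sigmaSix, Finset.filter_singleton]
  rw [FCoeff, FSeries, coeff_mul]
  simp only [numerSeries, coeff_mk, Finset.Nat.antidiagonal_succ, zero_add]
  simp [coeff_zero_etaSeries, hs]
  exact h1

lemma coeff_zero_FSeries : coeff 0 FSeries = 1 := by
  rw [FSeries, coeff_mul]
  simp [numerSeries, coeff_zero_etaSeries]

/-- The `q`-expansion of `F`. -/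
lemma hasSum_FC {z : ℂ} (hz : 0 < z.im) :
    HasSum (fun n => (FCoeff n : ℂ) * nome z ^ n) ((nome z)⁻¹ - FC z) := by
  have hne : nome z ≠ 0 := Complex.exp_ne_zero _
  have h := ((hasSum_nat_add_iff' 1).mpr (hasSum_FSeries hz)).mul_left (-(nome z)⁻¹)
  have e : -(nome z)⁻¹ * (nome z * FC z - ∑ i ∈ range 1,
      ((coeff i FSeries : ℝ) : ℂ) * nome z ^ i) = (nome z)⁻¹ - FC z := by
    rw [Finset.sum_range_one, coeff_zero_FSeries]
    push_cast
    field_simp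
    ring
  rw [e] at h
  refine hasSum_of_eq h fun n => ?_
  rw [FCoeff, pow_succ]
  push_cast
  field_simp

end QExpansion

/-! ### The expansion of `P` and its remainder -/

lemma hasDerivAt_nome (z : ℂ) : HasDerivAt nome (2 * Real.pi * Complex.I * nome z) z := by
  have h := ((hasDerivAt_id z).const_mul (2 * Real.pi * Complex.I)).cexp
  exact h.congr_deriv (by simp [nome, mul_comm])

lemma nome_ne_zero (z : ℂ) : nome z ≠ 0 := Complex.exp_ne_zero _

lemma norm_FCoeff_mul (n : ℕ) (z : ℂ) :
    ‖(FCoeff n : ℂ) * nome z ^ n‖ = FCoeff n * Real.exp (-(2 * Real.pi * z.im)) ^ n := by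
  rw [norm_mul, norm_pow, norm_nome, Complex.norm_real, Real.norm_of_nonneg (FCoeff_nonneg n)]

lemma summable_FCoeff {y : ℝ} (hy : 0 < y) :
    Summable fun n => FCoeff n * Real.exp (-(2 * Real.pi * y)) ^ n := by
  have h := (hasSum_FC (z := y * Complex.I) (by simpa using hy)).summable.norm
  refine h.congr fun n => ?_
  rw [norm_FCoeff_mul]
  simp

lemma isOpen_im_gt (c : ℝ) : IsOpen {z : ℂ | c < z.im} :=
  isOpen_lt continuous_const Complex.continuous_im

lemma hasDerivAt_FCoeff_mul (n : ℕ) (z : ℂ) :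
    HasDerivAt (fun z => (FCoeff n : ℂ) * nome z ^ n)
      (2 * Real.pi * Complex.I * (FCoeff n * n * nome z ^ n)) z := by
  refine (((hasDerivAt_nome z).pow n).const_mul (FCoeff n : ℂ)).congr_deriv ?_
  rcases n with _ | n
  · simp
  · simp only [Nat.add_sub_cancel, pow_succ]
    ring

lemma hasDerivAt_FC {z : ℂ} (hz : 0 < z.im) :
    ∃ s : ℂ, HasSum (fun n => (FCoeff n : ℂ) * n * nome z ^ n) s ∧
      HasDerivAt FC (-(2 * Real.pi * Complex.I) * ((nome z)⁻¹ + s)) z := by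
  have hy : 0 < z.im / 2 := by positivity
  -- On this half-plane around z the terms are dominated by their size on its boundary line, so the
  -- series may be differentiated termwise.
  have hbound : ∀ (n : ℕ), ∀ w ∈ {w : ℂ | z.im / 2 < w.im}, ‖(FCoeff n : ℂ) * nome w ^ n‖ ≤
      FCoeff n * Real.exp (-(2 * Real.pi * (z.im / 2))) ^ n := fun n w hw => by
    rw [norm_FCoeff_mul]
    have hw' : z.im / 2 < w.im := hw
    refine mul_le_mul_of_nonneg_left (pow_le_pow_left₀ (Real.exp_nonneg _)
      (Real.exp_le_exp.mpr ?_) n) (FCoeff_nonneg n)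
    have := Real.pi_pos
    nlinarith
  have hdiff : ∀ n : ℕ, DifferentiableOn ℂ (fun w => (FCoeff n : ℂ) * nome w ^ n)
      {w : ℂ | z.im / 2 < w.im} := fun n w _ =>
    (hasDerivAt_FCoeff_mul n w).differentiableAt.differentiableWithinAt
  have hmem : z ∈ {w : ℂ | z.im / 2 < w.im} := by
    show z.im / 2 < z.im
    linarith
  have hd := Complex.hasSum_deriv_of_summable_norm (summable_FCoeff hy) hdiff (isOpen_im_gt _)
    hbound hmem
  have hD := (Complex.differentiableOn_tsum_of_summable_norm (summable_FCoeff hy) hdiff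
    (isOpen_im_gt _) hbound).differentiableAt ((isOpen_im_gt _).mem_nhds hmem)
  set S := deriv (fun w => ∑' n, (FCoeff n : ℂ) * nome w ^ n) z with hS
  have h2 : (2 * Real.pi * Complex.I : ℂ) ≠ 0 := Complex.two_pi_I_ne_zero
  refine ⟨(2 * Real.pi * Complex.I)⁻¹ * S, ?_, ?_⟩
  · refine hasSum_of_eq (hd.mul_left _) fun n => ?_
    rw [(hasDerivAt_FCoeff_mul n z).deriv]
    field_simp
  · have hinv := (hasDerivAt_nome z).inv (nome_ne_zero z)
    have := hinv.sub hD.hasDerivAt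
    refine (this.congr_of_eventuallyEq ?_).congr_deriv ?_
    · filter_upwards [(isOpen_im_gt 0).mem_nhds hz] with w hw
      have := (hasSum_FC hw).tsum_eq
      simp only [Pi.sub_apply, Pi.inv_apply, this]
      ring
    · have := nome_ne_zero z
      rw [← hS]
      field_simp
      ring

lemma differentiableOn_FC : DifferentiableOn ℂ FC {z | 0 < z.im} := fun z hz => by
  obtain ⟨s, -, h⟩ := hasDerivAt_FC (z := z) hz
  exact h.differentiableAt.differentiableWithinAt

/-- The `q`-expansion of `P`. -/
lemma hasSum_PC {z : ℂ} (hz : 0 < z.im) :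
    HasSum (fun n : ℕ => (FCoeff n : ℂ) * (n + 1 / (2 * Real.pi * z.im)) * nome z ^ n)
      (PC z - (1 - 1 / (2 * Real.pi * z.im)) * (nome z)⁻¹) := by
  obtain ⟨s, hs, hd⟩ := hasDerivAt_FC hz
  have h := hs.add ((hasSum_FC hz).mul_left (1 / (2 * Real.pi * z.im) : ℂ))
  have hpi : (Real.pi : ℂ) ≠ 0 := by exact_mod_cast Real.pi_ne_zero
  have hI := Complex.I_ne_zero
  have e : PC z - (1 - 1 / (2 * Real.pi * z.im)) * (nome z)⁻¹ =
      s + 1 / (2 * Real.pi * z.im) * ((nome z)⁻¹ - FC z) := by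
    rw [PC, hd.deriv]
    field_simp
    ring
  rw [e]
  exact hasSum_of_eq h fun n => by ring

/-! ### The majorant of the remainder and its numerical value. -/

/-- The terms of the remainder of `P` on the imaginary axis. -/
def remTerm (y : ℝ) (n : ℕ) : ℝ :=
  FCoeff n * (n + 1 / (2 * Real.pi * y)) * Real.exp (-(2 * Real.pi * y)) ^ n

/-- The remainder of `P` on the imaginary axis. -/
def rem (y : ℝ) : ℝ := ∑' n, remTerm y n

lemma norm_PC_term {z : ℂ} (hz : 0 < z.im) (n : ℕ) :
    ‖(FCoeff n : ℂ) * (n + 1 / (2 * Real.pi * z.im)) * nome z ^ n‖ = remTerm z.im n := by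
  have hpi := Real.pi_pos
  have e : ((n : ℂ) + 1 / (2 * Real.pi * z.im)) = ((n + 1 / (2 * Real.pi * z.im) : ℝ) : ℂ) := by
    push_cast; rfl
  rw [norm_mul, norm_mul, norm_pow, norm_nome, e, Complex.norm_real, Complex.norm_real,
    Real.norm_of_nonneg (FCoeff_nonneg n), Real.norm_of_nonneg (by positivity), remTerm]

lemma summable_remTerm {y : ℝ} (hy : 0 < y) : Summable (remTerm y) := by
  have hz : 0 < (y * Complex.I).im := by simpa using hy
  refine (hasSum_PC hz).summable.norm.congr fun n => ?_
  rw [norm_PC_term hz]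
  simp

lemma remTerm_nonneg {y : ℝ} (hy : 0 < y) (n : ℕ) : 0 ≤ remTerm y n := by
  have hpi := Real.pi_pos
  have := FCoeff_nonneg n
  rw [remTerm]
  positivity

lemma norm_PC_sub_le {z : ℂ} (hz : 0 < z.im) :
    ‖PC z - (1 - 1 / (2 * Real.pi * z.im)) * (nome z)⁻¹‖ ≤ rem z.im := by
  rw [← (hasSum_PC hz).tsum_eq, rem]
  refine tsum_of_norm_bounded (summable_remTerm hz).hasSum fun n => ?_
  rw [norm_PC_term hz]

lemma PC_mul_I {y : ℝ} (hy : 0 < y) : PC (y * Complex.I) =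
    (((1 - 1 / (2 * Real.pi * y)) * Real.exp (2 * Real.pi * y) + rem y : ℝ) : ℂ) := by
  have hz : 0 < (y * Complex.I).im := by simpa using hy
  have hn : nome (y * Complex.I) = (Real.exp (-(2 * Real.pi * y)) : ℝ) := by
    rw [nome, Complex.ofReal_exp]
    congr 1
    push_cast
    linear_combination 2 * Real.pi * y * Complex.I_sq
  have h := hasSum_PC hz
  have h' : HasSum (fun n => ((remTerm y n : ℝ) : ℂ)) ((rem y : ℝ) : ℂ) :=
    Complex.hasSum_ofReal.mpr (summable_remTerm hy).hasSum
  have him : (y * Complex.I).im = y := by simp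
  rw [him] at h
  have := h.unique (hasSum_of_eq h' fun n => by rw [hn, remTerm]; push_cast; rfl)
  rw [hn, ← Complex.ofReal_inv, ← Real.exp_neg, neg_neg] at this
  push_cast at this ⊢
  linear_combination this

lemma remTerm_le {y₀ y : ℝ} (h0 : 0 < y₀) (h : y₀ ≤ y) (n : ℕ) :
    remTerm y n ≤ Real.exp (-(2 * Real.pi * (y - y₀))) ^ n * remTerm y₀ n := by
  have hpi := Real.pi_pos
  have hy : 0 < y := h0.trans_le h
  have he : Real.exp (-(2 * Real.pi * y)) =
      Real.exp (-(2 * Real.pi * (y - y₀))) * Real.exp (-(2 * Real.pi * y₀)) := by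
    rw [← Real.exp_add]
    congr 1
    ring
  rw [remTerm, remTerm, he, mul_pow]
  have h1 : 1 / (2 * Real.pi * y) ≤ 1 / (2 * Real.pi * y₀) := by gcongr
  have := FCoeff_nonneg n
  calc _ = Real.exp (-(2 * Real.pi * (y - y₀))) ^ n * (FCoeff n * (n + 1 / (2 * Real.pi * y)) *
        Real.exp (-(2 * Real.pi * y₀)) ^ n) := by ring
    _ ≤ _ := by gcongr

lemma rem_antitone {y₀ y : ℝ} (h0 : 0 < y₀) (h : y₀ ≤ y) : rem y ≤ rem y₀ := by
  refine (summable_remTerm (h0.trans_le h)).tsum_le_tsum (fun n => ?_) (summable_remTerm h0)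
  refine (remTerm_le h0 h n).trans (mul_le_of_le_one_left (remTerm_nonneg h0 n) ?_)
  refine pow_le_one₀ (Real.exp_nonneg _) (Real.exp_le_one_iff.mpr ?_)
  have : 0 ≤ 2 * Real.pi * (y - y₀) :=
    mul_nonneg (by have := Real.pi_pos; positivity) (sub_nonneg.mpr h)
  linarith

/-- The term n = 0 does not decay exponentially and is bounded through c_0 ≤ 12; every other term
gains at least one factor exp(-2π(y - y₀)). -/
lemma rem_le_add {y₀ y : ℝ} (h0 : 0 < y₀) (h : y₀ ≤ y) :
    rem y ≤ 12 / (2 * Real.pi * y) + Real.exp (-(2 * Real.pi * (y - y₀))) * rem y₀ := by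
  have hpi := Real.pi_pos
  have hy : 0 < y := h0.trans_le h
  have hR := ((summable_remTerm h0).hasSum.mul_left (Real.exp (-(2 * Real.pi * (y - y₀)))))
  have hE := (hasSum_ite_eq (0 : ℕ) (12 / (2 * Real.pi * y))).add hR
  refine hasSum_le (fun n => ?_) (summable_remTerm hy).hasSum hE
  have hexp : Real.exp (-(2 * Real.pi * (y - y₀))) ≤ 1 := by
    refine Real.exp_le_one_iff.mpr ?_
    have : 0 ≤ 2 * Real.pi * (y - y₀) := mul_nonneg (by positivity) (sub_nonneg.mpr h)
    linarith
  have hnn := remTerm_nonneg h0 n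
  by_cases hn : n = 0
  · subst hn
    have : remTerm y 0 ≤ 12 / (2 * Real.pi * y) := by
      rw [remTerm, pow_zero, mul_one, Nat.cast_zero, zero_add, mul_one_div]
      exact div_le_div_of_nonneg_right FCoeff_zero_le (by positivity)
    rw [if_pos rfl]
    exact this.trans (le_add_of_nonneg_right (by positivity))
  · rw [if_neg hn, zero_add]
    exact (remTerm_le h0 h n).trans (mul_le_mul_of_nonneg_right
      (pow_le_of_le_one (Real.exp_nonneg _) hexp hn) hnn)

/-- The two points are -1/z and z/6 for z = i√3/2, whose height is the least on the fundamental
domain. -/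
lemma PC_fricke : PC ((2 * √3 / 3 : ℝ) * Complex.I) = PC ((√3 / 12 : ℝ) * Complex.I) := by
  have hs : (0 : ℝ) < √3 := by positivity
  have hz : 0 < ((√3 / 2 : ℝ) * Complex.I).im := by simp
  have h := PC_of_FC differentiableOn_FC (a := 0) (b := -1) (c := 1) (d := 0) (h := 6) (r := 0)
    (κ := 1) (by norm_num) (by norm_num) (fun z hz => by simpa using FC_neg_inv hz) hz
  have hs3 : ((√3 : ℝ) : ℂ) ^ 2 = 3 := by
    rw [← Complex.ofReal_pow, Real.sq_sqrt (by norm_num)]; norm_num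
  have hsC : ((√3 : ℝ) : ℂ) ≠ 0 := by exact_mod_cast hs.ne'
  have hI := Complex.I_ne_zero
  push_cast at h
  simp only [zero_mul, zero_add, one_mul, add_zero] at h
  convert h using 2
  · push_cast
    rw [eq_div_iff (mul_ne_zero (div_ne_zero hsC two_ne_zero) hI)]
    field_simp
    rw [hs3, Complex.I_sq]
    norm_num
  · push_cast
    ring

lemma rem_bound : rem (√3 / 12) ≤ 1334.42 := by
  have hs0 : (0 : ℝ) < √3 := by positivity
  have hs1 : (1.732 : ℝ) < √3 := Real.lt_sqrt_of_sq_lt (by norm_num)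
  have hs2 : √3 < (1.7321 : ℝ) := (Real.sqrt_lt' (by norm_num)).mpr (by norm_num)
  have hp1 := Real.pi_gt_d4
  have hp2 := Real.pi_lt_d4
  have hpi := Real.pi_pos
  have hy0 : 0 < √3 / 12 := by positivity
  have hy1 : 0 < 2 * √3 / 3 := by positivity
  have hF := PC_fricke
  rw [PC_mul_I hy1, PC_mul_I hy0, Complex.ofReal_inj] at hF
  have hle := rem_le_add (y := 2 * √3 / 3) hy0 (by linarith)
  set R := rem (√3 / 12)
  have hR : 0 ≤ R := tsum_nonneg fun n => remTerm_nonneg hy0 n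
  have hps1 : (5.441 : ℝ) < Real.pi * √3 := by nlinarith
  have hps2 : Real.pi * √3 < 5.4416 := by nlinarith
  set A := 2 * Real.pi * (2 * √3 / 3) with hA
  set B := 2 * Real.pi * (√3 / 12) with hB
  have hA1 : 7.25 < A := by rw [hA]; linarith
  have hA2 : A < 7.26 := by rw [hA]; linarith
  have hB1 : 0.906 < B := by rw [hB]; linarith
  have hB2 : B < 1 := by rw [hB]; linarith
  have hAB : 2 * Real.pi * (2 * √3 / 3 - √3 / 12) = A - B := by rw [hA, hB]; ring
  rw [hAB] at hle
  have he1 := Real.exp_one_lt_d9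
  have he2 := Real.exp_one_gt_d9
  have hexpA : Real.exp A ≤ 1482 := by
    -- A < 7.26 is split as 7 + 0.26, and exp 0.26 ≤ 1/(1 - 0.26) follows from 1 + x ≤ exp x at x =
    -- -0.26.
    have h1 : Real.exp A ≤ Real.exp 1 ^ 7 * Real.exp 0.26 := by
      rw [← Real.exp_nat_mul, ← Real.exp_add]
      exact Real.exp_le_exp.mpr (by norm_num; linarith)
    have h2 : Real.exp 1 ^ 7 ≤ 2.7182818286 ^ 7 := by gcongr
    have h3 : Real.exp 0.26 ≤ 1 / 0.74 := by
      have := Real.add_one_le_exp (-0.26 : ℝ)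
      rw [← neg_neg (0.26 : ℝ), Real.exp_neg, ← one_div]
      exact one_div_le_one_div_of_le (by norm_num) (by linarith)
    calc _ ≤ _ := h1
      _ ≤ 2.7182818286 ^ 7 * (1 / 0.74) := by gcongr
      _ ≤ 1482 := by norm_num
  have hexpB : Real.exp B ≤ 2.72 := (Real.exp_le_exp.mpr hB2.le).trans (by linarith)
  have hexpAB : Real.exp (-(A - B)) ≤ 1 / 100 := by
    rw [Real.exp_neg, ← one_div]
    refine one_div_le_one_div_of_le (by norm_num) ?_
    have h1 : Real.exp 1 ^ 6 ≤ Real.exp (A - B) := by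
      rw [← Real.exp_nat_mul]
      exact Real.exp_le_exp.mpr (by norm_num; linarith)
    have h2 : (2.7 : ℝ) ^ 6 ≤ Real.exp 1 ^ 6 := by gcongr; linarith
    refine le_trans ?_ (h2.trans h1)
    norm_num
  have m1 : (1 - 1 / A) * Real.exp A ≤ (1 - 1 / 7.26) * 1482 := by
    have : 1 / 7.26 ≤ 1 / A := one_div_le_one_div_of_le (by linarith) hA2.le
    exact mul_le_mul (by linarith) hexpA (Real.exp_nonneg _) (by norm_num)
  have m2 : -((1 - 1 / B) * Real.exp B) ≤ (1 / 0.906 - 1) * 2.72 := by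
    rw [← neg_mul, neg_sub]
    have : 1 / B ≤ 1 / 0.906 := one_div_le_one_div_of_le (by norm_num) hB1.le
    exact mul_le_mul (by linarith) hexpB (Real.exp_nonneg _) (by norm_num)
  have m3 : 12 / A ≤ 12 / 7.25 := by gcongr
  have m4 : Real.exp (-(A - B)) * R ≤ 1 / 100 * R := by gcongr
  -- Together: R ≤ (1 - 1/A) exp A - (1 - 1/B) exp B + 12/A + R/100, with numerical part below 1280,
  -- so R < 1293.
  linarith

/-! ### The main estimate -/

lemma sqrt_three_div_two_le_im {τ : ℍ} (hτ : τ ∈ fundDomain) : √3 / 2 ≤ τ.im := by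
  have hn : ‖(τ : ℂ)‖ ^ 2 = τ.re ^ 2 + τ.im ^ 2 := by
    rw [← Complex.normSq_eq_norm_sq, Complex.normSq_apply, coe_re, coe_im]
    ring
  have him := τ.im_pos
  have key : 1 ≤ ‖(τ : ℂ)‖ ∧ -(1 / 2) ≤ τ.re ∧ τ.re ≤ 1 / 2 := by
    rcases hτ with ⟨h1, h2, h3⟩ | ⟨h1, h2, h3⟩
    · exact ⟨h3.le, h1.le, h2⟩
    · exact ⟨h1.ge, by linarith, h3⟩
  have h1 : 1 ≤ ‖(τ : ℂ)‖ ^ 2 := one_le_pow₀ key.1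
  rw [div_le_iff₀ two_pos]
  refine Real.sqrt_le_iff.mpr ⟨by positivity, ?_⟩
  nlinarith [key.2.1, key.2.2]

lemma coe_sl_smul (γ : SL(2, ℤ)) (τ : ℍ) :
    ((γ • τ : ℍ) : ℂ) = (γ 0 0 * τ + γ 0 1) / (γ 1 0 * τ + γ 1 1) := by
  rw [coe_specialLinearGroup_apply]
  simp

lemma exists_expansion {κ : ℂ} {h : ℕ} {r : ℤ} (hh : 0 < h) {f : ℍ → ℂ}
    (hf : ∀ τ : ℍ, f τ = κ * h * FC ((τ + r) / h)) :
    HasPolarExpansion f h (κ * Complex.exp (-(2 * Real.pi * Complex.I * r / h))) := by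
  refine ⟨fun n => -(κ * h) * FCoeff n * Complex.exp (2 * Real.pi * Complex.I * n * r / h),
    fun τ => ?_⟩
  have hz : 0 < (((τ : ℂ) + r) / h).im := by
    rw [Complex.div_natCast_im]
    have : (0 : ℝ) < h := by exact_mod_cast hh
    have := τ.im_pos
    simp
    positivity
  have hs := (hasSum_FC hz).mul_left (-(κ * h))
  have e : f τ - h * (κ * Complex.exp (-(2 * Real.pi * Complex.I * r / h))) *
      Complex.exp (-(2 * Real.pi * Complex.I * τ / h)) =
      -(κ * h) * ((nome ((τ + r) / h))⁻¹ - FC ((τ + r) / h)) := by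
    have : (nome ((τ + r) / h))⁻¹ = Complex.exp (-(2 * Real.pi * Complex.I * r / h)) *
      Complex.exp (-(2 * Real.pi * Complex.I * τ / h)) := by
      rw [nome, ← Complex.exp_neg, ← Complex.exp_add]
      congr 1
      ring
    rw [this, hf]
    ring
  rw [e]
  refine hasSum_of_eq hs fun n => ?_
  have : nome ((τ + r) / h) ^ n = Complex.exp (2 * Real.pi * Complex.I * n * r / h) *
      Complex.exp (2 * Real.pi * Complex.I * n * τ / h) := by
    rw [nome, ← Complex.exp_nat_mul, ← Complex.exp_add]
    congr 1
    ring
  rw [this]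
  ring

end PartitionMaass

end

theorem lemma3p3 (γ : SL(2, ℤ)) (hγ : γ ∈ PartitionMaass.cosetReps) (h : ℕ)
    (hh : h = PartitionMaass.cuspWidth (CongruenceSubgroup.Gamma0 6) γ) :
    ∃ ζ : ℂ, ζ ^ 6 = 1 ∧
      PartitionMaass.HasPolarExpansion (PartitionMaass.F ∣[(-2 : ℤ)] γ) h ζ ∧
      ∀ τ ∈ PartitionMaass.fundDomain,
        ‖(PartitionMaass.P ∣[(0 : ℤ)] γ) τ -
            ζ * (1 - (h : ℂ) / (2 * (Real.pi : ℂ) * (τ.im : ℂ))) *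
              Complex.exp (-(2 * (Real.pi : ℂ) * Complex.I * (τ : ℂ) / (h : ℂ)))‖ ≤ 1334.42 := by
  open PartitionMaass in
  obtain ⟨κ, r, hκ, hpos, ⟨k, hk⟩, H⟩ := FC_cosetReps hγ hh
  have hhR : (0 : ℝ) < h := by exact_mod_cast hpos
  have hhC : (h : ℂ) ≠ 0 := by exact_mod_cast hpos.ne'
  refine ⟨κ * Complex.exp (-(2 * Real.pi * Complex.I * r / h)), ?_, ?_, fun τ hτ => ?_⟩
  · have h6 : (6 : ℂ) = h * k := by exact_mod_cast hk
    have he : Complex.exp (-(2 * Real.pi * Complex.I * r / h)) ^ 6 = 1 := by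
      rw [← Complex.exp_nat_mul, Complex.exp_eq_one_iff]
      -- As 6 = hk, the sixth power of exp(-2πir/h) is exp(-2πirk).
      refine ⟨-(r * k), ?_⟩
      push_cast
      rw [h6]
      field_simp
    rw [mul_pow, he, mul_one, show 6 = 2 * 3 from rfl, pow_mul, hκ, one_pow]
  · refine exists_expansion hpos fun τ => ?_
    rw [ModularForm.SL_slash_apply, F_eq_FC, coe_sl_smul, ← H τ τ.im_pos, ModularGroup.denom_apply]
    norm_cast
  · have hP : (P ∣[(0 : ℤ)] γ) τ = κ * PC ((τ + r) / h) := by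
      rw [ModularForm.SL_slash_apply, P_eq_PC differentiableOn_FC, coe_sl_smul, neg_zero, zpow_zero,
        mul_one]
      have hdet : ((γ 0 0 : ℤ) : ℝ) * (γ 1 1 : ℤ) - (γ 0 1 : ℤ) * (γ 1 0 : ℤ) = 1 := by
        have := γ.det_coe
        rw [Matrix.det_fin_two] at this
        exact_mod_cast this
      have := PC_of_FC differentiableOn_FC (r := r) hdet hhR (κ := κ)
        (fun z hz => by simpa using! H z hz) τ.im_pos
      simpa using! this
    set w : ℂ := (τ + r) / h with hw
    have hwim : w.im = τ.im / h := by
      rw [hw, Complex.div_natCast_im]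
      simp
    have hw0 : 0 < w.im := by rw [hwim]; exact div_pos τ.im_pos hhR
    -- The worst case is the widest cusp, h = 6, at the lowest height √3/2.
    have hle : √3 / 12 ≤ w.im := by
      have h1 := sqrt_three_div_two_le_im hτ
      have h2 : (h : ℝ) ≤ 6 := by
        have := Nat.le_of_dvd (by norm_num) (Dvd.intro k hk.symm)
        exact_mod_cast this
      rw [hwim, le_div_iff₀ hhR]
      have : √3 / 12 * h ≤ √3 / 12 * 6 := by gcongr
      linarith
    have hκn : ‖κ‖ = 1 := by
      have := congrArg norm hκ
      rw [norm_pow, norm_one] at this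
      exact (pow_eq_one_iff_of_nonneg (norm_nonneg _) two_ne_zero).mp this
    have hnome : (nome w)⁻¹ = Complex.exp (-(2 * Real.pi * Complex.I * r / h)) *
        Complex.exp (-(2 * Real.pi * Complex.I * τ / h)) := by
      rw [nome, ← Complex.exp_neg, ← Complex.exp_add]
      congr 1
      rw [hw]
      ring
    have hmain : κ * PC w - κ * Complex.exp (-(2 * Real.pi * Complex.I * r / h)) *
        (1 - h / (2 * Real.pi * τ.im)) * Complex.exp (-(2 * Real.pi * Complex.I * τ / h)) =
        κ * (PC w - (1 - 1 / (2 * Real.pi * w.im)) * (nome w)⁻¹) := by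
      have e : (1 : ℂ) / (2 * Real.pi * w.im) = h / (2 * Real.pi * τ.im) := by
        rw [hwim]
        push_cast
        field_simp
      rw [e, hnome]
      ring
    rw [hP, hmain, norm_mul, hκn, one_mul]
    exact (norm_PC_sub_le hw0).trans ((rem_antitone (by positivity) hle).trans rem_bound)
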